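/- Let $d\ge 2$ be an integer and $k>0$. For $x=(x_1,\dots,x_d)\in\mathbb R^d$ put $\sigma x=(-x_1,x_2,\dots,x_d)$, let $\alpha=\sqrt2\,e_1$ and $\omega_k(x)=|\langle\alpha,x\rangle|^{2k}$ (root system $A_1$ in $\mathbb R^d$). Let $$V_kf(y)=\frac{\Gamma(k+\frac12)}{\sqrt\pi\,\Gamma(k)}\int_{-1}^1 f(ty_1,y_2,\dots,y_d)(1-t)^{k-1}(1+t)^k\,dt$$ be the rank-one intertwining operator, $E_k(x,y)=V_k\big(e^{\langle\cdot,y\rangle}\big)(x)$ the Dunkl kernel, $$\Gamma_k(t,x,y)=\frac{M_k}{t^{k+d/2}}\,e^{-(|x|^2+|y|^2)/4t}\,E_k\Big(\frac{x}{\sqrt{2t}},\frac{y}{\sqrt{2t}}\Big),\qquad M_k=2^{-k-d/2}\Big(\int_{\mathbb R^d}e^{-|x|^2/2}\omega_k(x)\,dx\Big)^{-1},$$ the Dunkl heat kernel, and $N_k(x,y)=\int_0^\infty\Gamma_k(t,x,y)\,dt\in[0,\infty]$ the Newton kernel. Let $\mathbb B$ be the open unit ball of $\mathbb R^d$. The Green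 function of $\mathbb B$ for the Dunkl Laplacian is the $[0,\infty]$-valued function $$G_k(x,y)=N_k(x,y)-|x|^{2-2k-d}N_k\big(x/|x|^2,\,y\big),\qquad x,y\in\mathbb B,$$ where for $x=0$ the subtracted term is replaced by its limit as $x\to0$, $x\ne 0$. Write $\delta(x)=1-|x|$, $\Phi(x,y)=|x-y|\vee|x-\sigma y|$, $a\vee b=\max(a,b)$, $a\wedge b=\min(a,b)$. Write $f\asymp g$ if there is a constant $C>0$, depending only on $d$ and $k$, such that $C^{-1}g(x,y)\le f(x,y)\le C\,g(x,y)$ for all $x,y\in\mathbb B$. Both sides are $[0,\infty]$-valued, with $a/0=\infty$ for $a>0$, $0/0=0$, $\log 0=-\infty$, $\log\infty=\infty$. Then the following hold. 1. If $d=2$, then $$G_k(x,y)\asymp\frac{1}{\Phi(x,y)^{2k}}\left(1\wedge\frac{\delta(x)\delta(y)}{|x-y|^{2}}\right)\left[1\vee\log\left(\frac{|x_1y_1|\wedge\delta(x)\delta(y)}{|x-y|^2}\right)\right]\left[1\vee\log\left(\frac{|x_1y_1|}{\delta(x)\delta(y)\vee|x-\sigma y|^2}\right)\right].$$ 2. If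 $d=3$, then $$G_k(x,y)\asymp\frac{1}{\Phi(x,y)^{2k}|x-y|}\left(1\wedge\frac{\sqrt{\delta(x)\delta(y)}}{|x-y|}\right)\left(1\wedge\frac{\sqrt{\delta(x)\delta(y)}}{|x-y|\wedge|x-\sigma y|}\right).$$ 3. If $d=4$, then $$G_k(x,y)\asymp\frac{1}{\Phi(x,y)^{2k}|x-y|^{2}}\left(1\wedge\frac{\delta(x)\delta(y)}{|x-y|^{2}\wedge|x-\sigma y|^2}\right)\left[1\vee\log\left(\frac{|x_1y_1|\wedge\delta(x)\delta(y)}{|x-\sigma y|^2}\right)\right].$$ 4. If $d\ge5$, then $$G_k(x,y)\asymp\frac{1}{\Phi(x,y)^{2k}\,(|x-y|\wedge|x-\sigma y|)^{d-4}\,|x-y|^{2}}\left(1\wedge\frac{\delta(x)\delta(y)}{|x-y|^{2}\wedge|x-\sigma y|^2}\right).$$ -/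

import Mathlib

open scoped ENNReal Topology

noncomputable section

namespace RankOneDunkl

variable {d : ℕ} [NeZero d]

/-- The map `(y₁, y₂, …, y_d) ↦ (t y₁, y₂, …, y_d)`; the first coordinate has index `0`. -/
def scaleFirst (t : ℝ) (y : EuclideanSpace ℝ (Fin d)) : EuclideanSpace ℝ (Fin d) :=
  WithLp.toLp 2 (Function.update (fun i => y i) 0 (t * y 0))

/-- The reflection `σ(x₁, x₂, …, x_d) = (-x₁, x₂, …, x_d)`. -/
def reflect (x : EuclideanSpace ℝ (Fin d)) : EuclideanSpace ℝ (Fin d) :=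
  WithLp.toLp 2 (Function.update (fun i => x i) 0 (-x 0))

/-- The root `α = √2 e₁` (of length `√2`, as in `A₁ = {±(e₁ - e₂)}` after the change of
orthonormal basis which turns its reflection into `reflect`). -/
def root : EuclideanSpace ℝ (Fin d) := EuclideanSpace.single 0 (Real.sqrt 2)

/-- The Dunkl weight `ω_k(x) = |⟨α, x⟩|^{2k}`. -/
def weight (k : ℝ) (x : EuclideanSpace ℝ (Fin d)) : ℝ :=
  |inner ℝ root x| ^ (2 * k)

/-- The normalizing constant `c_k = Γ(k + 1/2) / (√π Γ(k))`. -/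
def intertwinerConst (k : ℝ) : ℝ :=
  Real.Gamma (k + 1 / 2) / (Real.sqrt Real.pi * Real.Gamma k)

/-- The rank-one intertwining operator
`V_k f(y) = c_k ∫_{-1}^1 f(t y₁, y₂, …, y_d) (1 - t)^{k-1} (1 + t)^k dt`. -/
def intertwiner (k : ℝ) (f : EuclideanSpace ℝ (Fin d) → ℝ) (y : EuclideanSpace ℝ (Fin d)) : ℝ :=
  intertwinerConst k *
    ∫ t in (-1 : ℝ)..1, f (scaleFirst t y) * ((1 - t) ^ (k - 1) * (1 + t) ^ k)

/-- The Dunkl kernel `E_k(x, y) = V_k(e^{⟨·, y⟩})(x)`. -/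
def dunklKernel (k : ℝ) (x y : EuclideanSpace ℝ (Fin d)) : ℝ :=
  intertwiner k (fun z => Real.exp (inner ℝ z y)) x

/-- `M_k = 2^{-k-d/2} (∫ e^{-|x|²/2} ω_k(x) dx)⁻¹`. -/
def heatConst (d : ℕ) [NeZero d] (k : ℝ) : ℝ :=
  (2 : ℝ) ^ (-k - (d : ℝ) / 2) *
    (∫ x : EuclideanSpace ℝ (Fin d), Real.exp (-‖x‖ ^ 2 / 2) * weight k x)⁻¹

/-- The Dunkl heat kernel
`Γ_k(t, x, y) = M_k t^{-k-d/2} e^{-(|x|² + |y|²)/(4t)} E_k(x/√(2t), y/√(2t))`. -/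
def heatKernel (k t : ℝ) (x y : EuclideanSpace ℝ (Fin d)) : ℝ :=
  heatConst d k / t ^ (k + (d : ℝ) / 2) * Real.exp (-(‖x‖ ^ 2 + ‖y‖ ^ 2) / (4 * t)) *
    dunklKernel k ((Real.sqrt (2 * t))⁻¹ • x) ((Real.sqrt (2 * t))⁻¹ • y)

/-- The Newton kernel `N_k(x, y) = ∫_0^∞ Γ_k(t, x, y) dt`, with values in `[0, ∞]`. -/
def newtonKernel (k : ℝ) (x y : EuclideanSpace ℝ (Fin d)) : ℝ≥0∞ :=
  ∫⁻ t in Set.Ioi (0 : ℝ), ENNReal.ofReal (heatKernel k t x y)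

/-- The Kelvin transform `K_k[u](x) = |x|^{2-2k-d} u(x/|x|²)`, meant for `x ≠ 0`. -/
def kelvin (k : ℝ) (u : EuclideanSpace ℝ (Fin d) → ℝ≥0∞) (x : EuclideanSpace ℝ (Fin d)) :
    ℝ≥0∞ :=
  ENNReal.ofReal (‖x‖ ^ (2 - 2 * k - (d : ℝ))) * u ((‖x‖ ^ 2)⁻¹ • x)

open Classical in
/-- The Green function `G_k(x, y) = N_k(x, y) - K_k[N_k(·, y)](x)` of the unit ball, where the
Kelvin transform is extended to `x = 0` by its limit there. -/
def greenFunction (k : ℝ) (x y : EuclideanSpace ℝ (Fin d)) : ℝ≥0∞ :=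
  newtonKernel k x y -
    if x = 0 then
      Filter.limUnder (𝓝[≠] (0 : EuclideanSpace ℝ (Fin d))) (kelvin k fun z => newtonKernel k z y)
    else kelvin k (fun z => newtonKernel k z y) x

/-- `δ(x) = 1 - |x|`, the distance of a point `x` of the unit ball to the unit sphere. -/
def bdryDist (x : EuclideanSpace ℝ (Fin d)) : ℝ≥0∞ := ENNReal.ofReal (1 - ‖x‖)

/-- `Φ(x, y) = |x - y| ∨ |x - σy|`. -/
def Phi (x y : EuclideanSpace ℝ (Fin d)) : ℝ≥0∞ := max (edist x y) (edist x (reflect y))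

/-- `1 ∨ log r` for `r ∈ [0, ∞]`, where `log 0 = -∞` and `log ∞ = ∞`. -/
def oneMaxLog (r : ℝ≥0∞) : ℝ≥0∞ := max 1 (ENNReal.log r).toENNReal

/-- `f ≍ g` on `𝔹 × 𝔹`, for functions with values in `[0, ∞]`. -/
def ComparableOnBall (f g : EuclideanSpace ℝ (Fin d) → EuclideanSpace ℝ (Fin d) → ℝ≥0∞) : Prop :=
  ∃ C : ℝ, 0 < C ∧
    ∀ x ∈ Metric.ball (0 : EuclideanSpace ℝ (Fin d)) 1,
      ∀ y ∈ Metric.ball (0 : EuclideanSpace ℝ (Fin d)) 1,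
        ENNReal.ofReal C⁻¹ * g x y ≤ f x y ∧ f x y ≤ ENNReal.ofReal C * g x y

end RankOneDunkl

end

open RankOneDunkl

/-! Put m = k + d/2 − 1, a = |x−y|², b = |x−σy|², B = δ(x)δ(y). The Gaussian factor and the
exponential inside the Dunkl kernel combine into e^{−A(s)/4t}, where A is affine in s with A(−1) = b
and A(1) = a. Integrating in t makes N_k a constant times ∫ A(s)^{−m} w(s) ds, with w the Jacobi
weight. Inversion in x replaces A by A + B', where B' = (1−|x|²)(1−|y|²) lies between B and 4B.
Hence G_k is a constant times ∫ [A^{−m} − (A+B')^{−m}] w ds (`greenFunction_eq_lintegral`), and the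
bracket is comparable to φ(A) = A^{−m}(1 ∧ B/A) (`exists_comparable_greenProfile`).

What remains is one-dimensional. Let ε = a ∧ b and D = a ∨ b, and parametrize from the endpoint
where A = ε. Since φ is decreasing and doubling, only the behaviour of w at that endpoint matters:
if w behaves like v^{q−1} there, the integral is comparable to D^{−q}[φ(ε)ε^q + ∫_ε^D φ(w) w^{q−1}
dw] (`exists_comparable_lintegral_affine`). Here q = k if x₁y₁ ≥ 0 and q = k+1 if x₁y₁ ≤ 0, so
D^{−q} is Φ^{−2k} or Φ^{−2k}|x−y|^{−2}.

The parameter k then disappears from the remaining integral ∫_ε^D w^{−ν−1}(1 ∧ B/w) dw, where ν = m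
− q is d/2 − 1 or d/2 − 2. For ν > 0 the lower endpoint dominates; ν = 0 gives a logarithm over ε <
w < B; ν = −1/2 gives no logarithm; ν = −1 gives one over B < w < D (the `comparable_tail_*`
lemmas). These cases produce the split by dimension, and D − ε = 4|x₁y₁| brings |x₁y₁| into the
logarithms. Points where both sides are infinite are handled separately. -/

noncomputable section

namespace RankOneDunkl

open MeasureTheory Set

/-! ### Integral representation of the Newton kernel. -/

section Newton

variable {d : ℕ} [NeZero d]

/-- The weight `(1 - s)^{k-1} (1 + s)^k` of the intertwining operator. -/
def jacobiWeight (k s : ℝ) : ℝ := (1 - s) ^ (k - 1) * (1 + s) ^ k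

/-- The convex combination of `|x - y|²` and `|x - σy|²` which is affine in `s`, with values
`|x - σy|²` at `-1` and `|x - y|²` at `1`. -/
def sqDistInterp (x y : EuclideanSpace ℝ (Fin d)) (s : ℝ) : ℝ :=
  (1 + s) / 2 * ‖x - y‖ ^ 2 + (1 - s) / 2 * ‖x - reflect y‖ ^ 2

theorem scaleFirst_eq (t : ℝ) (y : EuclideanSpace ℝ (Fin d)) :
    scaleFirst t y = y + EuclideanSpace.single 0 ((t - 1) * y 0) := by
  ext i
  by_cases h : i = 0
  · subst h; simp [scaleFirst]; ring
  · simp [scaleFirst, h]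

theorem reflect_eq (y : EuclideanSpace ℝ (Fin d)) :
    reflect y = y + EuclideanSpace.single 0 (-2 * y 0) := by
  ext i
  by_cases h : i = 0
  · subst h; simp [reflect]; ring
  · simp [reflect, h]

theorem inner_scaleFirst (t : ℝ) (x y : EuclideanSpace ℝ (Fin d)) :
    inner ℝ (scaleFirst t x) y = inner ℝ x y + (t - 1) * (x 0 * y 0) := by
  rw [scaleFirst_eq, inner_add_left, EuclideanSpace.inner_single_left]
  simp; ring

theorem inner_reflect (x y : EuclideanSpace ℝ (Fin d)) :
    inner ℝ x (reflect y) = inner ℝ x y - 2 * (x 0 * y 0) := by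
  rw [reflect_eq, inner_add_right, EuclideanSpace.inner_single_right]
  simp; ring

theorem norm_reflect_sq (y : EuclideanSpace ℝ (Fin d)) : ‖reflect y‖ ^ 2 = ‖y‖ ^ 2 := by
  rw [← real_inner_self_eq_norm_sq, inner_reflect, real_inner_comm, inner_reflect,
    real_inner_self_eq_norm_sq]
  simp [reflect]

theorem sqDistInterp_eq (x y : EuclideanSpace ℝ (Fin d)) (s : ℝ) :
    sqDistInterp x y s = ‖x‖ ^ 2 + ‖y‖ ^ 2 - 2 * (inner ℝ x y + (s - 1) * (x 0 * y 0)) := by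
  rw [sqDistInterp, norm_sub_sq_real, norm_sub_sq_real, norm_reflect_sq, inner_reflect]
  ring

theorem norm_sub_reflect_sq (x y : EuclideanSpace ℝ (Fin d)) :
    ‖x - reflect y‖ ^ 2 = ‖x - y‖ ^ 2 + 4 * (x 0 * y 0) := by
  rw [norm_sub_sq_real, norm_sub_sq_real, norm_reflect_sq, inner_reflect]
  ring

theorem weight_eq (k : ℝ) (x : EuclideanSpace ℝ (Fin d)) :
    weight k x = (2 * x 0 ^ 2) ^ k := by
  rw [weight, root, EuclideanSpace.inner_single_left, Real.rpow_mul (abs_nonneg _)]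
  congr 1
  simp [mul_pow]

/-- Half of the Gaussian decay absorbs the power weight. Integrability is what makes `heatConst`
nonzero, since a divergent Bochner integral would be 0. -/
theorem integrable_gaussian_mul_weight {k : ℝ} (hk : 0 < k) :
    Integrable fun x : EuclideanSpace ℝ (Fin d) => Real.exp (-‖x‖ ^ 2 / 2) * weight k x := by
  have hg : Integrable fun x : EuclideanSpace ℝ (Fin d) => Real.exp (-(1 / 4) * ‖x‖ ^ 2) := by
    have := (GaussianFourier.integrable_cexp_neg_mul_sq_norm_add
      (V := EuclideanSpace ℝ (Fin d)) (b := ((1 / 4 : ℝ) : ℂ)) (by simp) 0 0).re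
    refine this.congr (Filter.Eventually.of_forall fun x => ?_)
    have : Complex.exp (-((1 / 4 : ℝ) : ℂ) * (‖x‖ : ℂ) ^ 2 + 0 * ((inner ℝ 0 x : ℝ) : ℂ)) =
        ((Real.exp (-(1 / 4) * ‖x‖ ^ 2) : ℝ) : ℂ) := by
      push_cast; simp
    beta_reduce
    rw [this]
    exact Complex.ofReal_re _
  refine (hg.const_mul ((8 * k) ^ k)).mono' ?_ (Filter.Eventually.of_forall fun x => ?_)
  · refine Continuous.aestronglyMeasurable ?_
    simp only [weight_eq]
    refine Continuous.mul (by fun_prop) (Continuous.rpow_const (by fun_prop) fun x => Or.inr hk.le)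
  · rw [weight_eq, Real.norm_of_nonneg (by positivity)]
    have h0 : x 0 ^ 2 ≤ ‖x‖ ^ 2 := by
      have := PiLp.norm_apply_le x 0
      rw [← sq_abs]
      exact pow_le_pow_left₀ (abs_nonneg _) this 2
    -- With z = |x|²/(4k), the inequality z ≤ e^z gives 2x₁² ≤ 8kz ≤ 8k e^z; then raise to the power
    -- k.
    have h1 : (2 * x 0 ^ 2) ^ k ≤ (8 * k) ^ k * Real.exp (‖x‖ ^ 2 / 4) := by
      calc (2 * x 0 ^ 2) ^ k ≤ (8 * k * Real.exp (‖x‖ ^ 2 / (4 * k))) ^ k := by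
            refine Real.rpow_le_rpow (by positivity) ?_ hk.le
            have h2 := Real.add_one_le_exp (‖x‖ ^ 2 / (4 * k))
            have h3 : 8 * k * (‖x‖ ^ 2 / (4 * k)) = 2 * ‖x‖ ^ 2 := by field_simp; ring
            nlinarith
        _ = (8 * k) ^ k * Real.exp (‖x‖ ^ 2 / 4) := by
            rw [Real.mul_rpow (by positivity) (by positivity), ← Real.exp_mul]
            congr 2; field_simp
    calc Real.exp (-‖x‖ ^ 2 / 2) * (2 * x 0 ^ 2) ^ k
        ≤ Real.exp (-‖x‖ ^ 2 / 2) * ((8 * k) ^ k * Real.exp (‖x‖ ^ 2 / 4)) := by gcongr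
      _ = (8 * k) ^ k * (Real.exp (-‖x‖ ^ 2 / 2) * Real.exp (‖x‖ ^ 2 / 4)) := by ring
      _ = _ := by rw [← Real.exp_add]; congr 2; ring

theorem heatConst_pos {k : ℝ} (hk : 0 < k) : 0 < heatConst d k := by
  refine mul_pos (by positivity) (inv_pos.2 ?_)
  rw [integral_pos_iff_support_of_nonneg (fun x => by simp only [weight_eq]; positivity)
    (integrable_gaussian_mul_weight hk)]
  have ho : IsOpen {x : EuclideanSpace ℝ (Fin d) | x 0 ≠ 0} :=
    isOpen_ne_fun (by fun_prop) continuous_const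
  refine (ho.measure_pos volume ⟨EuclideanSpace.single 0 1, by simp⟩).trans_le
    (measure_mono fun x hx => ?_)
  have hx' : x 0 ≠ 0 := hx
  rw [Function.mem_support, weight_eq]
  positivity

theorem intertwinerConst_pos {k : ℝ} (hk : 0 < k) : 0 < intertwinerConst k := by
  have := Real.Gamma_pos_of_pos hk
  have := Real.Gamma_pos_of_pos (show 0 < k + 1 / 2 by linarith)
  have := Real.pi_pos
  unfold intertwinerConst
  positivity

theorem jacobiWeight_nonneg (k : ℝ) {s : ℝ} (hs : s ∈ Ioo (-1 : ℝ) 1) : 0 ≤ jacobiWeight k s :=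
  mul_nonneg (Real.rpow_nonneg (by linarith [hs.2]) _) (Real.rpow_nonneg (by linarith [hs.1]) _)

theorem measurable_jacobiWeight (k : ℝ) : Measurable (jacobiWeight k) := by
  unfold jacobiWeight; fun_prop

theorem integrableOn_jacobiWeight {k : ℝ} (hk : 0 < k) :
    IntegrableOn (jacobiWeight k) (Ioo (-1) 1) := by
  have h1 : IntervalIntegrable (fun s : ℝ => (1 - s) ^ (k - 1)) volume (-1) 1 := by
    have := (intervalIntegral.intervalIntegrable_rpow' (a := 2) (b := 0)
      (show -1 < k - 1 by linarith)).comp_sub_left 1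
    norm_num at this
    exact this
  have h2 : IntegrableOn (fun s : ℝ => 2 ^ k * (1 - s) ^ (k - 1)) (Ioo (-1) 1) :=
    (((intervalIntegrable_iff_integrableOn_Ioc_of_le (by norm_num)).1 h1).mono_set
      Ioo_subset_Ioc_self).const_mul _
  refine h2.mono' (measurable_jacobiWeight k).aestronglyMeasurable ?_
  refine (ae_restrict_iff' measurableSet_Ioo).2 (Filter.Eventually.of_forall fun s hs => ?_)
  rw [Real.norm_of_nonneg (jacobiWeight_nonneg k hs), jacobiWeight, mul_comm]
  have := Real.rpow_nonneg (show 0 ≤ 1 - s by linarith [hs.2]) (k - 1)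
  gcongr
  · linarith [hs.1]
  · linarith [hs.2]

/-- `∫_0^∞ t^{-m-1} e^{-1/(4t)} dt`. -/
def heatTimeConst (m : ℝ) : ℝ≥0∞ :=
  ∫⁻ t in Ioi (0 : ℝ), ENNReal.ofReal (t ^ (-m - 1) * Real.exp (-1 / (4 * t)))

/-- The substitution t = 1/y turns this into the Gamma-type integral of y^{m−1} e^{−y/4}. -/
theorem heatTimeConst_ne_top {m : ℝ} (hm : 0 < m) : heatTimeConst m ≠ ⊤ := by
  have h1 : IntegrableOn (fun y : ℝ => y ^ (m - 1) * Real.exp (-(1 / 4) * y ^ (1 : ℝ))) (Ioi 0) :=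
    integrableOn_rpow_mul_exp_neg_mul_rpow (by linarith) (by norm_num) (by norm_num)
  have h2 := (integrableOn_Ioi_comp_rpow_iff' _ (show (-1 : ℝ) ≠ 0 by norm_num)).2 h1
  have h3 : IntegrableOn (fun t : ℝ => t ^ (-m - 1) * Real.exp (-1 / (4 * t))) (Ioi 0) := by
    refine h2.congr_fun (fun t ht => ?_) measurableSet_Ioi
    have ht : 0 < t := ht
    simp only [smul_eq_mul, Real.rpow_one]
    rw [← mul_assoc, ← Real.rpow_mul ht.le, ← Real.rpow_add ht, Real.rpow_neg_one]
    congr 2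
    · ring
    · field_simp
  exact h3.lintegral_lt_top.ne

theorem heatTimeConst_ne_zero (m : ℝ) : heatTimeConst m ≠ 0 := by
  unfold heatTimeConst
  have hm : Measurable fun t : ℝ => ENNReal.ofReal (t ^ (-m - 1) * Real.exp (-1 / (4 * t))) := by
    fun_prop
  rw [← pos_iff_ne_zero, setLIntegral_pos_iff hm]
  have : Ioi (0 : ℝ) ⊆
      (Function.support fun t : ℝ => ENNReal.ofReal (t ^ (-m - 1) * Real.exp (-1 / (4 * t)))) ∩
        Ioi 0 := by
    intro t ht
    have ht' : (0 : ℝ) < t := ht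
    refine ⟨?_, ht⟩
    rw [Function.mem_support, ← pos_iff_ne_zero, ENNReal.ofReal_pos]
    positivity
  refine lt_of_lt_of_le ?_ (measure_mono this)
  simp

/-- Rescale t by A. For A = 0 both sides are infinite, because t^{−m−1} is not integrable at 0;
including this case lets the kernel formula hold on the singular set as well. -/
theorem lintegral_rpow_mul_exp_neg_div {m : ℝ} (hm : 0 < m) {A : ℝ} (hA : 0 ≤ A) :
    ∫⁻ t in Ioi (0 : ℝ), ENNReal.ofReal (t ^ (-m - 1) * Real.exp (-A / (4 * t))) =
      heatTimeConst m * ENNReal.ofReal A ^ (-m) := by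
  rcases hA.eq_or_lt with rfl | hA
  · rw [ENNReal.ofReal_zero, ENNReal.zero_rpow_of_neg (by linarith),
      ENNReal.mul_top (heatTimeConst_ne_zero m)]
    simp only [neg_zero, zero_div, Real.exp_zero, mul_one]
    by_contra h
    have h1 : IntegrableOn (fun t : ℝ => t ^ (-m - 1)) (Ioi 0) := by
      refine (lintegral_ofReal_ne_top_iff_integrable ?_ ?_).1 h
      · exact Measurable.aestronglyMeasurable (by fun_prop)
      · exact (ae_restrict_iff' measurableSet_Ioi).2
          (Filter.Eventually.of_forall fun t ht => Real.rpow_nonneg (le_of_lt ht) _)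
    have := (intervalIntegral.integrableOn_Ioo_rpow_iff (one_pos (α := ℝ))).1
      (h1.mono_set Ioo_subset_Ioi_self)
    linarith
  · have hi : (fun t => A * t) '' Ioi (0 : ℝ) = Ioi 0 := by
      ext t
      simp only [mem_image, mem_Ioi]
      exact ⟨fun ⟨u, hu, h⟩ => h ▸ by positivity, fun h => ⟨t / A, by positivity, by field_simp⟩⟩
    have h := lintegral_image_eq_lintegral_abs_deriv_mul (s := Ioi 0) (f := fun t => A * t)
      (f' := fun _ => A) measurableSet_Ioi
      (fun t _ => by simpa using ((hasDerivAt_id t).const_mul A).hasDerivWithinAt)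
      (fun t _ u _ h => mul_left_cancel₀ hA.ne' h)
      (fun t => ENNReal.ofReal (t ^ (-m - 1) * Real.exp (-A / (4 * t))))
    rw [hi] at h
    rw [h, ENNReal.ofReal_rpow_of_pos hA, heatTimeConst, mul_comm,
      ← lintegral_const_mul' _ _ ENNReal.ofReal_ne_top]
    refine setLIntegral_congr_fun measurableSet_Ioi fun t ht => ?_
    have ht : 0 < t := ht
    rw [← ENNReal.ofReal_mul (abs_nonneg _), ← ENNReal.ofReal_mul (by positivity), abs_of_pos hA,
      Real.mul_rpow hA.le ht.le]
    congr 1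
    have h1 : -A / (4 * (A * t)) = -1 / (4 * t) := by field_simp
    have h2 : A * A ^ (-m - 1) = A ^ (-m) := by
      nth_rewrite 1 [← Real.rpow_one A]
      rw [← Real.rpow_add hA]; congr 1; ring
    rw [h1, ← h2]; ring

theorem sqDistInterp_nonneg (x y : EuclideanSpace ℝ (Fin d)) {s : ℝ} (hs : s ∈ Ioo (-1 : ℝ) 1) :
    0 ≤ sqDistInterp x y s := by
  have h1 : 0 ≤ 1 + s := by linarith [hs.1]
  have h2 : 0 ≤ 1 - s := by linarith [hs.2]
  unfold sqDistInterp; positivity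

/-- Polarization: −(|x|²+|y|²)/4t plus the exponent ⟨x_s, y⟩/2t, with x_s the point x with first
coordinate scaled by s, equals −A(s)/4t. Tonelli can then exchange s and t. -/
theorem ofReal_heatKernel {k : ℝ} (hk : 0 < k) {t : ℝ} (ht : 0 < t)
    (x y : EuclideanSpace ℝ (Fin d)) :
    ENNReal.ofReal (heatKernel k t x y) =
      ∫⁻ s in Ioo (-1 : ℝ) 1, ENNReal.ofReal (heatConst d k * intertwinerConst k) *
        (ENNReal.ofReal (jacobiWeight k s) * ENNReal.ofReal
          (t ^ (-(k + (d : ℝ) / 2 - 1) - 1) * Real.exp (-sqDistInterp x y s / (4 * t)))) := by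
  set r := (Real.sqrt (2 * t))⁻¹ with hr
  have hr2 : r * r = 1 / (2 * t) := by
    rw [hr, ← mul_inv, Real.mul_self_sqrt (by positivity)]; simp
  have hexp : ∀ s, inner ℝ (scaleFirst s (r • x)) (r • y) =
      1 / (2 * t) * (inner ℝ x y + (s - 1) * (x 0 * y 0)) := by
    intro s
    rw [inner_scaleFirst, real_inner_smul_left, real_inner_smul_right, ← hr2]
    simp; ring
  have hint : IntegrableOn (fun s => Real.exp (inner ℝ (scaleFirst s (r • x)) (r • y)) *
      ((1 - s) ^ (k - 1) * (1 + s) ^ k)) (Ioo (-1) 1) := by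
    simp only [hexp]
    have hc : Continuous fun s : ℝ =>
        Real.exp (1 / (2 * t) * (inner ℝ x y + (s - 1) * (x 0 * y 0))) := by fun_prop
    obtain ⟨C, hC⟩ := (isCompact_Icc (a := (-1 : ℝ)) (b := 1)).exists_bound_of_continuousOn
      hc.continuousOn
    refine Integrable.bdd_mul (c := C) (integrableOn_jacobiWeight hk) hc.aestronglyMeasurable ?_
    exact (ae_restrict_iff' measurableSet_Ioo).2
      (Filter.Eventually.of_forall fun s hs => hC s (Ioo_subset_Icc_self hs))
  rw [heatKernel, dunklKernel, intertwiner, intervalIntegral.integral_of_le (by norm_num),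
    integral_Ioc_eq_integral_Ioo, ← mul_assoc, ← integral_const_mul,
    ofReal_integral_eq_lintegral_ofReal (hint.const_mul _)]
  · refine setLIntegral_congr_fun measurableSet_Ioo fun s hs => ?_
    have hw := jacobiWeight_nonneg k hs
    have h1 := heatConst_pos (d := d) hk
    have h2 := intertwinerConst_pos hk
    rw [← ENNReal.ofReal_mul hw, ← ENNReal.ofReal_mul (by positivity), hexp]
    congr 1
    have h3 : Real.exp (-sqDistInterp x y s / (4 * t)) = Real.exp (-(‖x‖ ^ 2 + ‖y‖ ^ 2) / (4 * t)) *
        Real.exp (1 / (2 * t) * (inner ℝ x y + (s - 1) * (x 0 * y 0))) := by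
      rw [← Real.exp_add, sqDistInterp_eq]
      congr 1; field_simp; ring
    have h4 : t ^ (-(k + (d : ℝ) / 2 - 1) - 1) = (t ^ (k + (d : ℝ) / 2))⁻¹ := by
      rw [← Real.rpow_neg ht.le]; congr 1; ring
    rw [h3, h4, jacobiWeight]
    ring
  · refine (ae_restrict_iff' measurableSet_Ioo).2 (Filter.Eventually.of_forall fun s hs => ?_)
    have hw := jacobiWeight_nonneg k hs
    have h1 := heatConst_pos (d := d) hk
    have h2 := intertwinerConst_pos hk
    unfold jacobiWeight at hw
    simp only [Pi.zero_apply]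
    positivity

/-- The constant in front of the potential-type representation of the Newton kernel. -/
def newtonConst (d : ℕ) [NeZero d] (k : ℝ) : ℝ≥0∞ :=
  ENNReal.ofReal (heatConst d k * intertwinerConst k) * heatTimeConst (k + (d : ℝ) / 2 - 1)

theorem newtonConst_ne_zero {k : ℝ} (hk : 0 < k) : newtonConst d k ≠ 0 := by
  refine mul_ne_zero ?_ (heatTimeConst_ne_zero _)
  rw [← pos_iff_ne_zero, ENNReal.ofReal_pos]
  exact mul_pos (heatConst_pos hk) (intertwinerConst_pos hk)

theorem newtonConst_ne_top {k : ℝ} (hm : 0 < k + (d : ℝ) / 2 - 1) : newtonConst d k ≠ ⊤ :=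
  ENNReal.mul_ne_top ENNReal.ofReal_ne_top (heatTimeConst_ne_top hm)

theorem newtonKernel_eq_lintegral {k : ℝ} (hk : 0 < k) (hm : 0 < k + (d : ℝ) / 2 - 1)
    (x y : EuclideanSpace ℝ (Fin d)) :
    newtonKernel k x y = newtonConst d k * ∫⁻ s in Ioo (-1 : ℝ) 1,
      ENNReal.ofReal (sqDistInterp x y s) ^ (-(k + (d : ℝ) / 2 - 1)) *
        ENNReal.ofReal (jacobiWeight k s) := by
  have hJ := measurable_jacobiWeight k
  have hA : Measurable (sqDistInterp x y) := by unfold sqDistInterp; fun_prop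
  rw [newtonKernel, setLIntegral_congr_fun measurableSet_Ioi
    (fun t ht => ofReal_heatKernel hk ht x y), lintegral_lintegral_swap (by fun_prop),
    ← lintegral_const_mul' _ _ (newtonConst_ne_top hm)]
  refine setLIntegral_congr_fun measurableSet_Ioo fun s hs => ?_
  rw [lintegral_const_mul' _ _ ENNReal.ofReal_ne_top, lintegral_const_mul' _ _ ENNReal.ofReal_ne_top,
    lintegral_rpow_mul_exp_neg_div hm (sqDistInterp_nonneg x y hs), newtonConst]
  ring

/-! ### Kelvin transform and the integral formula for the Green function. -/

/-- The product `(1 - |x|²)(1 - |y|²)`. -/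
def ballFactor {d : ℕ} (x y : EuclideanSpace ℝ (Fin d)) : ℝ := (1 - ‖x‖ ^ 2) * (1 - ‖y‖ ^ 2)

theorem ballFactor_pos {d : ℕ} {x y : EuclideanSpace ℝ (Fin d)} (hx : ‖x‖ < 1) (hy : ‖y‖ < 1) :
    0 < ballFactor x y := by
  have := norm_nonneg x
  have := norm_nonneg y
  exact mul_pos (by nlinarith) (by nlinarith)

theorem measurable_sqDistInterp (x y : EuclideanSpace ℝ (Fin d)) :
    Measurable (sqDistInterp x y) := by
  unfold sqDistInterp; fun_prop

/-- This is the classical identity for |x|²|x/|x|² − y|². It survives for every s because the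
interpolation only changes the bilinear term, which is homogeneous in x. -/
theorem norm_sq_mul_sqDistInterp_inversion {x : EuclideanSpace ℝ (Fin d)} (hx : x ≠ 0)
    (y : EuclideanSpace ℝ (Fin d)) (s : ℝ) :
    ‖x‖ ^ 2 * sqDistInterp ((‖x‖ ^ 2)⁻¹ • x) y s = sqDistInterp x y s + ballFactor x y := by
  have h : ‖x‖ ≠ 0 := norm_ne_zero_iff.2 hx
  rw [sqDistInterp_eq, sqDistInterp_eq, ballFactor, norm_smul, real_inner_smul_left]
  simp only [norm_inv, norm_pow, norm_norm, PiLp.smul_apply, smul_eq_mul]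
  field_simp
  ring

theorem kelvin_newtonKernel {k : ℝ} (hk : 0 < k) (hm : 0 < k + (d : ℝ) / 2 - 1)
    {x : EuclideanSpace ℝ (Fin d)} (hx : x ≠ 0) (y : EuclideanSpace ℝ (Fin d)) :
    kelvin k (fun z => newtonKernel k z y) x = newtonConst d k * ∫⁻ s in Ioo (-1 : ℝ) 1,
      ENNReal.ofReal (sqDistInterp x y s + ballFactor x y) ^ (-(k + (d : ℝ) / 2 - 1)) *
        ENNReal.ofReal (jacobiWeight k s) := by
  have h : 0 < ‖x‖ := norm_pos_iff.2 hx
  rw [kelvin, newtonKernel_eq_lintegral hk hm, mul_left_comm,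
    ← lintegral_const_mul' _ _ ENNReal.ofReal_ne_top]
  congr 1
  refine setLIntegral_congr_fun measurableSet_Ioo fun s hs => ?_
  have h1 : ‖x‖ ^ (2 - 2 * k - (d : ℝ)) = (‖x‖ ^ 2) ^ (-(k + (d : ℝ) / 2 - 1)) := by
    rw [← Real.rpow_natCast, ← Real.rpow_mul h.le]
    congr 1; push_cast; ring
  rw [h1, ← ENNReal.ofReal_rpow_of_pos (by positivity), ← mul_assoc,
    ← ENNReal.mul_rpow_of_ne_top ENNReal.ofReal_ne_top ENNReal.ofReal_ne_top,
    ← ENNReal.ofReal_mul (by positivity), norm_sq_mul_sqDistInterp_inversion hx]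

theorem lintegral_jacobiWeight_ne_top {k : ℝ} (hk : 0 < k) :
    ∫⁻ s in Ioo (-1 : ℝ) 1, ENNReal.ofReal (jacobiWeight k s) ≠ ⊤ :=
  (integrableOn_jacobiWeight hk).lintegral_lt_top.ne

theorem rpow_sqDistInterp_add_le {m : ℝ} (hm : 0 < m) (x y : EuclideanSpace ℝ (Fin d)) {s b b' : ℝ}
    (hs : s ∈ Ioo (-1 : ℝ) 1) (hb : b ≤ b') :
    ENNReal.ofReal (sqDistInterp x y s + b') ^ (-m) ≤ ENNReal.ofReal b ^ (-m) := by
  rw [ENNReal.rpow_neg, ENNReal.rpow_neg, ENNReal.inv_le_inv]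
  gcongr
  linarith [sqDistInterp_nonneg x y hs]

/-- Near x = 0 the ball factor is bounded below, so the integrand is dominated by a multiple of the
weight. This identifies the limit that defines the subtracted term at x = 0. -/
theorem tendsto_kelvin_integral {k : ℝ} (hk : 0 < k) {m : ℝ} (hm : 0 < m)
    {y : EuclideanSpace ℝ (Fin d)} (hy : ‖y‖ < 1) :
    Filter.Tendsto (fun x => ∫⁻ s in Ioo (-1 : ℝ) 1,
      ENNReal.ofReal (sqDistInterp x y s + ballFactor x y) ^ (-m) *
        ENNReal.ofReal (jacobiWeight k s)) (𝓝 0) (𝓝 (∫⁻ s in Ioo (-1 : ℝ) 1,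
      ENNReal.ofReal (sqDistInterp 0 y s + ballFactor 0 y) ^ (-m) *
        ENNReal.ofReal (jacobiWeight k s))) := by
  have hJ := measurable_jacobiWeight k
  have hy' : 0 < 1 - ‖y‖ ^ 2 := by nlinarith [norm_nonneg y]
  refine tendsto_lintegral_filter_of_dominated_convergence
    (fun s => ENNReal.ofReal (1 / 2 * (1 - ‖y‖ ^ 2)) ^ (-m) * ENNReal.ofReal (jacobiWeight k s))
    (Filter.Eventually.of_forall fun x => ?_) ?_ ?_ ?_
  · have := measurable_sqDistInterp x y
    fun_prop
  · filter_upwards [Metric.ball_mem_nhds (0 : EuclideanSpace ℝ (Fin d))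
      (show (0 : ℝ) < 1 / 2 by norm_num)] with x hx
    rw [mem_ball_zero_iff] at hx
    refine (ae_restrict_iff' measurableSet_Ioo).2 (Filter.Eventually.of_forall fun s hs => ?_)
    refine mul_le_mul_left (rpow_sqDistInterp_add_le hm x y hs ?_) _
    exact mul_le_mul_of_nonneg_right (by nlinarith [norm_nonneg x]) hy'.le
  · rw [lintegral_const_mul _ (by fun_prop)]
    refine ENNReal.mul_ne_top ?_ (lintegral_jacobiWeight_ne_top hk)
    rw [ENNReal.ofReal_rpow_of_pos (by positivity)]
    exact ENNReal.ofReal_ne_top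
  · refine Filter.Eventually.of_forall fun s => ?_
    refine ENNReal.Tendsto.mul_const ?_ (Or.inr ENNReal.ofReal_ne_top)
    have hc : Continuous fun x : EuclideanSpace ℝ (Fin d) =>
        sqDistInterp x y s + ballFactor x y := by
      simp only [sqDistInterp, ballFactor]; fun_prop
    exact ((ENNReal.continuous_rpow_const.comp
      (ENNReal.continuous_ofReal.comp hc)).tendsto 0)

theorem greenFunction_eq_lintegral {k : ℝ} (hk : 0 < k) (hm : 0 < k + (d : ℝ) / 2 - 1)
    {x y : EuclideanSpace ℝ (Fin d)} (hx : ‖x‖ < 1) (hy : ‖y‖ < 1) :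
    greenFunction k x y = newtonConst d k * ∫⁻ s in Ioo (-1 : ℝ) 1,
      (ENNReal.ofReal (sqDistInterp x y s) ^ (-(k + (d : ℝ) / 2 - 1)) -
        ENNReal.ofReal (sqDistInterp x y s + ballFactor x y) ^ (-(k + (d : ℝ) / 2 - 1))) *
        ENNReal.ofReal (jacobiWeight k s) := by
  have hJ := measurable_jacobiWeight k
  have hA := measurable_sqDistInterp x y
  have hB := ballFactor_pos hx hy
  set m := k + (d : ℝ) / 2 - 1 with hmdef
  have hsub : (if x = 0 then Filter.limUnder (𝓝[≠] (0 : EuclideanSpace ℝ (Fin d)))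
      (kelvin k fun z => newtonKernel k z y) else kelvin k (fun z => newtonKernel k z y) x) =
      newtonConst d k * ∫⁻ s in Ioo (-1 : ℝ) 1,
        ENNReal.ofReal (sqDistInterp x y s + ballFactor x y) ^ (-m) *
          ENNReal.ofReal (jacobiWeight k s) := by
    split_ifs with h
    · subst h
      -- A `Tendsto` statement determines `limUnder` only if 0 is not isolated.
      have : Nontrivial (EuclideanSpace ℝ (Fin d)) :=
        ⟨⟨EuclideanSpace.single 0 1, 0, fun h => by simpa using congrArg (fun z => z 0) h⟩⟩
      have : (𝓝[≠] (0 : EuclideanSpace ℝ (Fin d))).NeBot := Module.punctured_nhds_neBot ℝ _ _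
      refine Filter.Tendsto.limUnder_eq ?_
      have ht := ENNReal.Tendsto.const_mul (a := newtonConst d k)
        ((tendsto_kelvin_integral (d := d) hk hm hy).mono_left (nhdsWithin_le_nhds (s := {0}ᶜ)))
        (Or.inr (newtonConst_ne_top hm))
      refine ht.congr' ?_
      filter_upwards [self_mem_nhdsWithin] with z hz
      exact (kelvin_newtonKernel hk hm hz y).symm
    · exact kelvin_newtonKernel hk hm h y
  rw [greenFunction, hsub, newtonKernel_eq_lintegral hk hm,
    ← ENNReal.mul_sub fun _ _ => newtonConst_ne_top hm, ← lintegral_sub']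
  · congr 1
    refine setLIntegral_congr_fun measurableSet_Ioo fun s hs => ?_
    exact (ENNReal.sub_mul fun _ _ => ENNReal.ofReal_ne_top).symm
  · exact Measurable.aemeasurable (by fun_prop)
  -- Subtraction passes under the integral because the Kelvin term is finite: A + B' ≥ B' > 0 even
  -- where the Newton kernel is infinite.
  · refine ne_top_of_le_ne_top
      (b := ENNReal.ofReal (ballFactor x y) ^ (-m) * ∫⁻ s in Ioo (-1 : ℝ) 1,
        ENNReal.ofReal (jacobiWeight k s)) ?_ ?_
    · refine ENNReal.mul_ne_top ?_ (lintegral_jacobiWeight_ne_top hk)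
      rw [ENNReal.ofReal_rpow_of_pos hB]
      exact ENNReal.ofReal_ne_top
    · rw [← lintegral_const_mul _ (by fun_prop)]
      refine setLIntegral_mono' measurableSet_Ioo fun s hs => ?_
      exact mul_le_mul_left (rpow_sqDistInterp_add_le hm x y hs le_rfl) _
  · refine (ae_restrict_iff' measurableSet_Ioo).2 (Filter.Eventually.of_forall fun s hs => ?_)
    refine mul_le_mul_left ?_ _
    rw [ENNReal.rpow_neg, ENNReal.rpow_neg, ENNReal.inv_le_inv]
    gcongr
    linarith

end Newton

/-! ### Calculus of two-sided comparison. -/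

/-- Two-sided comparison of extended nonnegative numbers with the constant `C`. -/
def Comparable (C : ℝ) (f g : ℝ≥0∞) : Prop :=
  f ≤ ENNReal.ofReal C * g ∧ g ≤ ENNReal.ofReal C * f

namespace Comparable

variable {C C' : ℝ} {f g h : ℝ≥0∞}

theorem refl (f : ℝ≥0∞) : Comparable 1 f f := by simp [Comparable]

theorem trans (hC : 0 ≤ C) (H : Comparable C f g) (H' : Comparable C' g h) :
    Comparable (C * C') f h := by
  have e : ENNReal.ofReal (C * C') = ENNReal.ofReal C * ENNReal.ofReal C' := ENNReal.ofReal_mul hC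
  refine ⟨?_, ?_⟩
  · calc f ≤ ENNReal.ofReal C * g := H.1
      _ ≤ ENNReal.ofReal C * (ENNReal.ofReal C' * h) := by gcongr; exact H'.1
      _ = _ := by rw [e, mul_assoc]
  · calc h ≤ ENNReal.ofReal C' * g := H'.2
      _ ≤ ENNReal.ofReal C' * (ENNReal.ofReal C * f) := by gcongr; exact H.2
      _ = _ := by rw [e]; ring

theorem mono (H : Comparable C f g) (hC : C ≤ C') : Comparable C' f g :=
  ⟨H.1.trans (by gcongr), H.2.trans (by gcongr)⟩

theorem mul_left (H : Comparable C f g) (a : ℝ≥0∞) : Comparable C (a * f) (a * g) := by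
  refine ⟨?_, ?_⟩
  · rw [mul_left_comm]; gcongr; exact H.1
  · rw [mul_left_comm]; gcongr; exact H.2

theorem mul_right (H : Comparable C f g) (a : ℝ≥0∞) : Comparable C (f * a) (g * a) := by
  rw [mul_comm f, mul_comm g]; exact H.mul_left a

theorem const_mul {a : ℝ} (ha : 0 < a) (f : ℝ≥0∞) :
    Comparable (max a a⁻¹) (ENNReal.ofReal a * f) f := by
  refine ⟨by gcongr; exact le_max_left _ _, ?_⟩
  rw [← mul_assoc, ← ENNReal.ofReal_mul (by positivity)]
  calc f = ENNReal.ofReal 1 * f := by simp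
    _ ≤ _ := by
      gcongr
      calc 1 = a⁻¹ * a := by field_simp
        _ ≤ _ := by gcongr; exact le_max_right _ _

theorem ofReal {f g : ℝ} (hC : 0 ≤ C) (h1 : f ≤ C * g) (h2 : g ≤ C * f) :
    Comparable C (ENNReal.ofReal f) (ENNReal.ofReal g) := by
  unfold Comparable
  rw [← ENNReal.ofReal_mul hC, ← ENNReal.ofReal_mul hC]
  exact ⟨ENNReal.ofReal_le_ofReal h1, ENNReal.ofReal_le_ofReal h2⟩

theorem setLIntegral {s : Set ℝ} (hs : MeasurableSet s) {f g : ℝ → ℝ≥0∞}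
    (H : ∀ x ∈ s, Comparable C (f x) (g x)) :
    Comparable C (∫⁻ x in s, f x) (∫⁻ x in s, g x) := by
  unfold Comparable
  rw [← lintegral_const_mul' _ _ ENNReal.ofReal_ne_top,
    ← lintegral_const_mul' _ _ ENNReal.ofReal_ne_top]
  exact ⟨setLIntegral_mono' hs fun x hx => (H x hx).1, setLIntegral_mono' hs fun x hx => (H x hx).2⟩

end Comparable

/-! ### Weighted integrals of decreasing functions on the unit interval. -/

/-- For decreasing ψ, the part over (1/2, 1) costs at most ψ(1/2) times the mass of w₁ there, and
ψ(1/2) is controlled by the integral over (0, 1/2]. So pointwise comparison of the weights is needed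
only near 0. -/
theorem lintegral_antitone_mul_le {ψ w₁ w₂ : ℝ → ℝ≥0∞} {L : ℝ≥0∞} (hψ : AntitoneOn ψ (Ioo 0 1))
    (hL : L ≠ ⊤) (hw : ∀ v ∈ Ioc (0 : ℝ) (1 / 2), w₁ v ≤ L * w₂ v) (h₁ : Measurable w₁)
    (h₂ : ∫⁻ v in Ioc (0 : ℝ) (1 / 2), w₂ v ≠ ⊤) (h₂' : ∫⁻ v in Ioc (0 : ℝ) (1 / 2), w₂ v ≠ 0) :
    ∫⁻ v in Ioo (0 : ℝ) 1, ψ v * w₁ v ≤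
      (L + (∫⁻ v in Ioo (1 / 2 : ℝ) 1, w₁ v) / ∫⁻ v in Ioc (0 : ℝ) (1 / 2), w₂ v) *
        ∫⁻ v in Ioo (0 : ℝ) 1, ψ v * w₂ v := by
  have hsub : Ioc (0 : ℝ) (1 / 2) ⊆ Ioo 0 1 := fun v hv => ⟨hv.1, by linarith [hv.2]⟩
  have hsub' : Ioo (1 / 2 : ℝ) 1 ⊆ Ioo 0 1 := fun v hv => ⟨by linarith [hv.1], hv.2⟩
  have hhalf : (1 / 2 : ℝ) ∈ Ioo (0 : ℝ) 1 := by norm_num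
  set c := ∫⁻ v in Ioc (0 : ℝ) (1 / 2), w₂ v with hc
  set M := ∫⁻ v in Ioo (1 / 2 : ℝ) 1, w₁ v with hM
  have hI : ∫⁻ v in Ioc (0 : ℝ) (1 / 2), ψ v * w₂ v ≤ ∫⁻ v in Ioo (0 : ℝ) 1, ψ v * w₂ v :=
    lintegral_mono_set hsub
  have h1 : ∫⁻ v in Ioc (0 : ℝ) (1 / 2), ψ v * w₁ v ≤
      L * ∫⁻ v in Ioc (0 : ℝ) (1 / 2), ψ v * w₂ v := by
    rw [← lintegral_const_mul' _ _ hL]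
    refine setLIntegral_mono' measurableSet_Ioc fun v hv => ?_
    rw [mul_left_comm]
    gcongr
    exact hw v hv
  have h2 : ∫⁻ v in Ioo (1 / 2 : ℝ) 1, ψ v * w₁ v ≤ ψ (1 / 2) * M := by
    rw [hM, ← lintegral_const_mul _ h₁]
    refine setLIntegral_mono' measurableSet_Ioo fun v hv => ?_
    gcongr
    exact hψ hhalf (hsub' hv) hv.1.le
  have h3 : ψ (1 / 2) * c ≤ ∫⁻ v in Ioc (0 : ℝ) (1 / 2), ψ v * w₂ v := by
    refine (lintegral_const_mul_le _ _).trans ?_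
    refine setLIntegral_mono' measurableSet_Ioc fun v hv => ?_
    gcongr
    exact hψ (hsub hv) hhalf hv.2
  have h4 : ψ (1 / 2) * M = M / c * (ψ (1 / 2) * c) := by
    rw [mul_left_comm, ENNReal.div_mul_cancel h₂' h₂]
  have hu : Ioo (0 : ℝ) 1 = Ioc 0 (1 / 2) ∪ Ioo (1 / 2) 1 :=
    (Ioc_union_Ioo_eq_Ioo (by norm_num) (by norm_num)).symm
  calc ∫⁻ v in Ioo (0 : ℝ) 1, ψ v * w₁ v
      ≤ (∫⁻ v in Ioc (0 : ℝ) (1 / 2), ψ v * w₁ v) + ∫⁻ v in Ioo (1 / 2 : ℝ) 1, ψ v * w₁ v := by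
        rw [hu]; exact lintegral_union_le _ _ _
    _ ≤ L * (∫⁻ v in Ioo (0 : ℝ) 1, ψ v * w₂ v) +
        M / c * ∫⁻ v in Ioo (0 : ℝ) 1, ψ v * w₂ v := by
        refine add_le_add (h1.trans (by gcongr)) (h2.trans ?_)
        rw [h4]
        gcongr
        exact h3.trans hI
    _ = _ := (add_mul _ _ _).symm

theorem rpow_le_two_rpow_abs {u : ℝ} (h1 : 1 / 2 ≤ u) (h2 : u ≤ 1) (p : ℝ) : u ^ p ≤ 2 ^ |p| := by
  have hu : 0 < u := by linarith
  rcases le_total 0 p with hp | hp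
  · exact (Real.rpow_le_one hu.le h2 hp).trans (Real.one_le_rpow (by norm_num) (abs_nonneg p))
  · rw [abs_of_nonpos hp]
    calc u ^ p ≤ (1 / 2 : ℝ) ^ p := Real.rpow_le_rpow_of_nonpos (by norm_num) h1 hp
      _ = 2 ^ (-p) := by rw [one_div, Real.inv_rpow (by norm_num), Real.rpow_neg (by norm_num)]

theorem one_le_two_rpow_abs_mul {u : ℝ} (h1 : 1 / 2 ≤ u) (h2 : u ≤ 1) (p : ℝ) :
    1 ≤ 2 ^ |p| * u ^ p := by
  have h := rpow_le_two_rpow_abs h1 h2 (-p)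
  have hu : 0 < u := by linarith
  have hp : 0 < u ^ p := Real.rpow_pos_of_pos hu _
  rw [abs_neg, Real.rpow_neg hu.le] at h
  calc 1 = (u ^ p)⁻¹ * u ^ p := by field_simp
    _ ≤ _ := by gcongr

theorem lintegral_rpow_ne_top {q : ℝ} (hq : 0 < q) (b : ℝ) (hb : 0 ≤ b) :
    ∫⁻ v in Ioc (0 : ℝ) b, ENNReal.ofReal (v ^ (q - 1)) ≠ ⊤ := by
  have h := (intervalIntegrable_iff_integrableOn_Ioc_of_le hb).1
    (intervalIntegral.intervalIntegrable_rpow' (a := 0) (b := b) (show -1 < q - 1 by linarith))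
  exact h.lintegral_lt_top.ne

theorem lintegral_one_sub_rpow_ne_top {r : ℝ} (hr : 0 < r) :
    ∫⁻ v in Ioo (1 / 2 : ℝ) 1, ENNReal.ofReal ((1 - v) ^ (r - 1)) ≠ ⊤ := by
  have h := (intervalIntegral.intervalIntegrable_rpow' (a := 1 / 2) (b := 0)
      (show -1 < r - 1 by linarith)).comp_sub_left 1
  norm_num at h
  have h' := (intervalIntegrable_iff_integrableOn_Ioc_of_le (by norm_num)).1 h
  exact (h'.mono_set Ioo_subset_Ioc_self).lintegral_lt_top.ne

theorem lintegral_ofReal_ne_zero {f : ℝ → ℝ} (hf : Measurable f) {a b : ℝ} (hab : a < b)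
    (h : ∀ v ∈ Ioc a b, 0 < f v) : ∫⁻ v in Ioc a b, ENNReal.ofReal (f v) ≠ 0 := by
  rw [← pos_iff_ne_zero, setLIntegral_pos_iff (by fun_prop)]
  have : Ioc a b ⊆ (Function.support fun v => ENNReal.ofReal (f v)) ∩ Ioc a b := by
    intro v hv
    refine ⟨?_, hv⟩
    rw [Function.mem_support, ← pos_iff_ne_zero, ENNReal.ofReal_pos]
    exact h v hv
  refine lt_of_lt_of_le ?_ (measure_mono this)
  simpa using hab

/-- The factor (1−v)^{r−1} is bounded above and below on (0, 1/2] and integrable at 1, so the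
previous lemma applies in both directions, with a constant independent of ψ. -/
theorem exists_comparable_beta_lintegral {q r : ℝ} (hq : 0 < q) (hr : 0 < r) :
    ∃ C : ℝ, 0 < C ∧ ∀ ψ : ℝ → ℝ≥0∞, AntitoneOn ψ (Ioo 0 1) →
      Comparable C (∫⁻ v in Ioo (0 : ℝ) 1, ψ v * ENNReal.ofReal (v ^ (q - 1) * (1 - v) ^ (r - 1)))
        (∫⁻ v in Ioo (0 : ℝ) 1, ψ v * ENNReal.ofReal (v ^ (q - 1))) := by
  set w₁ : ℝ → ℝ≥0∞ := fun v => ENNReal.ofReal (v ^ (q - 1) * (1 - v) ^ (r - 1)) with hw₁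
  set w₂ : ℝ → ℝ≥0∞ := fun v => ENNReal.ofReal (v ^ (q - 1)) with hw₂
  set L : ℝ≥0∞ := ENNReal.ofReal (2 ^ |r - 1|) with hL
  have hLt : L ≠ ⊤ := ENNReal.ofReal_ne_top
  have m₁ : Measurable w₁ := by fun_prop
  have m₂ : Measurable w₂ := by fun_prop
  have h12 : ∀ v ∈ Ioc (0 : ℝ) (1 / 2), w₁ v ≤ L * w₂ v := fun v hv => by
    have h0 := Real.rpow_nonneg hv.1.le (q - 1)
    rw [hL, ← ENNReal.ofReal_mul (by positivity)]
    refine ENNReal.ofReal_le_ofReal ?_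
    rw [mul_comm]
    gcongr
    exact rpow_le_two_rpow_abs (by linarith [hv.2]) (by linarith [hv.1]) _
  have h21 : ∀ v ∈ Ioc (0 : ℝ) (1 / 2), w₂ v ≤ L * w₁ v := fun v hv => by
    have h0 := Real.rpow_nonneg hv.1.le (q - 1)
    rw [hL, ← ENNReal.ofReal_mul (by positivity)]
    refine ENNReal.ofReal_le_ofReal ?_
    have := one_le_two_rpow_abs_mul (u := 1 - v) (by linarith [hv.2]) (by linarith [hv.1]) (r - 1)
    nlinarith
  have c₂ : ∫⁻ v in Ioc (0 : ℝ) (1 / 2), w₂ v ≠ ⊤ := lintegral_rpow_ne_top hq _ (by norm_num)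
  have c₁ : ∫⁻ v in Ioc (0 : ℝ) (1 / 2), w₁ v ≠ ⊤ := by
    refine ne_top_of_le_ne_top (ENNReal.mul_ne_top hLt c₂) ?_
    rw [← lintegral_const_mul' _ _ hLt]
    exact setLIntegral_mono' measurableSet_Ioc h12
  have z₂ : ∫⁻ v in Ioc (0 : ℝ) (1 / 2), w₂ v ≠ 0 :=
    lintegral_ofReal_ne_zero (by fun_prop) (by norm_num) fun v hv => Real.rpow_pos_of_pos hv.1 _
  have z₁ : ∫⁻ v in Ioc (0 : ℝ) (1 / 2), w₁ v ≠ 0 :=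
    lintegral_ofReal_ne_zero (by fun_prop) (by norm_num) fun v hv =>
      mul_pos (Real.rpow_pos_of_pos hv.1 _) (Real.rpow_pos_of_pos (by linarith [hv.2]) _)
  have M₂ : ∫⁻ v in Ioo (1 / 2 : ℝ) 1, w₂ v ≠ ⊤ := by
    refine ne_top_of_le_ne_top (lintegral_rpow_ne_top hq 1 (by norm_num)) (lintegral_mono_set ?_)
    exact fun v hv => ⟨by linarith [hv.1], hv.2.le⟩
  have M₁ : ∫⁻ v in Ioo (1 / 2 : ℝ) 1, w₁ v ≠ ⊤ := by
    refine ne_top_of_le_ne_top (ENNReal.mul_ne_top (ENNReal.ofReal_ne_top (r := 2 ^ |q - 1|))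
      (lintegral_one_sub_rpow_ne_top hr)) ?_
    rw [← lintegral_const_mul' _ _ ENNReal.ofReal_ne_top]
    refine setLIntegral_mono' measurableSet_Ioo fun v hv => ?_
    have h0 := Real.rpow_nonneg (show 0 ≤ 1 - v by linarith [hv.2]) (r - 1)
    rw [← ENNReal.ofReal_mul (by positivity)]
    refine ENNReal.ofReal_le_ofReal ?_
    gcongr
    exact rpow_le_two_rpow_abs hv.1.le hv.2.le _
  set K₁ := L + (∫⁻ v in Ioo (1 / 2 : ℝ) 1, w₁ v) / ∫⁻ v in Ioc (0 : ℝ) (1 / 2), w₂ v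
  set K₂ := L + (∫⁻ v in Ioo (1 / 2 : ℝ) 1, w₂ v) / ∫⁻ v in Ioc (0 : ℝ) (1 / 2), w₁ v
  have hK₁ : K₁ ≠ ⊤ := ENNReal.add_ne_top.2 ⟨hLt, ENNReal.div_ne_top M₁ z₂⟩
  have hK₂ : K₂ ≠ ⊤ := ENNReal.add_ne_top.2 ⟨hLt, ENNReal.div_ne_top M₂ z₁⟩
  refine ⟨1 + K₁.toReal + K₂.toReal, by positivity, fun ψ hψ => ⟨?_, ?_⟩⟩
  · refine (lintegral_antitone_mul_le hψ hLt h12 m₁ c₂ z₂).trans ?_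
    gcongr
    refine ENNReal.le_ofReal_iff_toReal_le hK₁ (by positivity) |>.2 ?_
    linarith [K₂.toReal_nonneg]
  · refine (lintegral_antitone_mul_le hψ hLt h21 m₂ c₁ z₁).trans ?_
    gcongr
    refine ENNReal.le_ofReal_iff_toReal_le hK₂ (by positivity) |>.2 ?_
    linarith [K₁.toReal_nonneg]

theorem lintegral_scale {D q : ℝ} (hD : 0 < D) (ψ : ℝ → ℝ≥0∞) :
    ∫⁻ v in Ioc (0 : ℝ) 1, ψ (D * v) * ENNReal.ofReal (v ^ (q - 1)) =
      ENNReal.ofReal (D ^ (-q)) * ∫⁻ w in Ioc (0 : ℝ) D, ψ w * ENNReal.ofReal (w ^ (q - 1)) := by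
  have hi : (fun t => D * t) '' Ioc (0 : ℝ) 1 = Ioc 0 D := by
    rw [image_mul_left_Ioc hD]; simp
  have h := lintegral_image_eq_lintegral_abs_deriv_mul (s := Ioc 0 1) (f := fun t => D * t)
    (f' := fun _ => D) measurableSet_Ioc
    (fun t _ => by simpa using ((hasDerivAt_id t).const_mul D).hasDerivWithinAt)
    (fun t _ u _ h => mul_left_cancel₀ hD.ne' h)
    (fun w => ψ w * ENNReal.ofReal (w ^ (q - 1)))
  rw [← hi, h, ← lintegral_const_mul' _ _ ENNReal.ofReal_ne_top]
  refine setLIntegral_congr_fun measurableSet_Ioc fun v hv => ?_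
  have hv0 : 0 < v := hv.1
  have e : v ^ (q - 1) = D ^ (-q) * (D * (D * v) ^ (q - 1)) := by
    rw [Real.mul_rpow hD.le hv0.le]
    have : D ^ (-q) * D * D ^ (q - 1) = 1 := by
      nth_rewrite 2 [← Real.rpow_one D]
      rw [← Real.rpow_add hD, ← Real.rpow_add hD]
      simp
    linear_combination (-v ^ (q - 1)) * this
  rw [e, ENNReal.ofReal_mul (by positivity), ENNReal.ofReal_mul hD.le, abs_of_pos hD]
  ring

theorem lintegral_rpow {q : ℝ} (hq : 0 < q) {b : ℝ} (hb : 0 ≤ b) :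
    ∫⁻ v in Ioc (0 : ℝ) b, ENNReal.ofReal (v ^ (q - 1)) = ENNReal.ofReal (b ^ q / q) := by
  have h := (intervalIntegrable_iff_integrableOn_Ioc_of_le hb).1
    (intervalIntegral.intervalIntegrable_rpow' (a := 0) (b := b) (show -1 < q - 1 by linarith))
  rw [← ofReal_integral_eq_lintegral_ofReal h, ← intervalIntegral.integral_of_le hb,
    integral_rpow (Or.inl (by linarith))]
  · simp [Real.zero_rpow hq.ne']
  · exact (ae_restrict_iff' measurableSet_Ioc).2
      (Filter.Eventually.of_forall fun v hv => Real.rpow_nonneg hv.1.le _)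

/-- Weighted integrals over `(0, 1)` of a decreasing doubling function of `ε + c v`. -/
theorem exists_comparable_lintegral_affine {q r K : ℝ} (hq : 0 < q) (hr : 0 < r) (hK : 1 ≤ K) :
    ∃ C : ℝ, 0 < C ∧ ∀ φ : ℝ → ℝ≥0∞, AntitoneOn φ (Ioi 0) →
      (∀ A, 0 < A → φ A ≤ ENNReal.ofReal K * φ (2 * A)) → ∀ ε D : ℝ, 0 ≤ ε → ε ≤ D → 0 < D →
      Comparable C (∫⁻ v in Ioo (0 : ℝ) 1,
          φ (ε + (D - ε) * v) * ENNReal.ofReal (v ^ (q - 1) * (1 - v) ^ (r - 1)))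
        (ENNReal.ofReal (D ^ (-q)) * (φ ε * ENNReal.ofReal (ε ^ q) +
          ∫⁻ w in Ioc ε D, φ w * ENNReal.ofReal (w ^ (q - 1)))) := by
  obtain ⟨C, hC, H⟩ := exists_comparable_beta_lintegral hq hr
  refine ⟨K * C * max q q⁻¹, by positivity, fun φ hφ hφK ε D hε hεD hD => ?_⟩
  have hpos : ∀ v ∈ Ioo (0 : ℝ) 1, 0 < max ε (D * v) := fun v hv =>
    lt_max_of_lt_right (mul_pos hD hv.1)
  -- The point ε + (D−ε)v lies between max(ε, Dv) and twice it, so monotonicity and doubling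
  -- exchange the two.
  have step1 : Comparable K (∫⁻ v in Ioo (0 : ℝ) 1,
      φ (ε + (D - ε) * v) * ENNReal.ofReal (v ^ (q - 1) * (1 - v) ^ (r - 1)))
      (∫⁻ v in Ioo (0 : ℝ) 1,
      φ (max ε (D * v)) * ENNReal.ofReal (v ^ (q - 1) * (1 - v) ^ (r - 1))) := by
    refine Comparable.setLIntegral measurableSet_Ioo fun v hv => Comparable.mul_right ?_ _
    have h1 : max ε (D * v) ≤ ε + (D - ε) * v := by
      refine max_le ?_ ?_ <;> nlinarith [hv.1, hv.2]
    have h2 : ε + (D - ε) * v ≤ 2 * max ε (D * v) := by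
      have := le_max_left ε (D * v)
      have := le_max_right ε (D * v)
      nlinarith [hv.1, hv.2]
    have hp := hpos v hv
    have hp' : 0 < ε + (D - ε) * v := hp.trans_le h1
    refine ⟨(hφ hp hp' h1).trans ?_, (hφK _ hp).trans ?_⟩
    · calc φ (max ε (D * v)) = ENNReal.ofReal 1 * φ (max ε (D * v)) := by simp
        _ ≤ _ := by gcongr
    · gcongr
      exact hφ hp' (show (0 : ℝ) < 2 * max ε (D * v) by linarith) h2
  have step2 := H (fun v => φ (max ε (D * v))) fun v hv v' hv' h =>
    hφ (hpos v hv) (hpos v' hv') (by gcongr)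
  -- After scaling w = Dv, split at w = ε: below it φ is frozen at φ(ε), and w^{q−1} integrates to
  -- ε^q/q.
  have step3 : ∫⁻ v in Ioo (0 : ℝ) 1, φ (max ε (D * v)) * ENNReal.ofReal (v ^ (q - 1)) =
      ENNReal.ofReal (D ^ (-q)) * (ENNReal.ofReal q⁻¹ * (φ ε * ENNReal.ofReal (ε ^ q)) +
        ∫⁻ w in Ioc ε D, φ w * ENNReal.ofReal (w ^ (q - 1))) := by
    rw [Measure.restrict_congr_set Ioo_ae_eq_Ioc,
      lintegral_scale (ψ := fun w => φ (max ε w)) hD, ← Ioc_union_Ioc_eq_Ioc hε hεD,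
      lintegral_union measurableSet_Ioc (Ioc_disjoint_Ioc_of_le le_rfl)]
    congr 2
    · rw [setLIntegral_congr_fun (g := fun w => φ ε * ENNReal.ofReal (w ^ (q - 1)))
        measurableSet_Ioc (fun w hw => by simp only [max_eq_left hw.2]),
        lintegral_const_mul _ (by fun_prop), lintegral_rpow hq hε, div_eq_mul_inv, mul_comm (ε ^ q),
        ENNReal.ofReal_mul (by positivity)]
      ring
    · exact setLIntegral_congr_fun measurableSet_Ioc fun w hw => by simp only [max_eq_right hw.1.le]
  rw [step3] at step2
  refine ((step1.trans (by positivity) step2).trans (by positivity) (Comparable.mul_left ?_ _))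
  set P := φ ε * ENNReal.ofReal (ε ^ q)
  set Q := ∫⁻ w in Ioc ε D, φ w * ENNReal.ofReal (w ^ (q - 1))
  have h1 : Comparable (max q q⁻¹) (ENNReal.ofReal q⁻¹ * P) P := by
    have := Comparable.const_mul (inv_pos.2 hq) P
    rwa [inv_inv, max_comm] at this
  have h2 : Comparable (max q q⁻¹) Q Q := by
    refine (Comparable.refl Q).mono ?_
    rcases le_total 1 q with h | h
    · exact le_max_of_le_left h
    · exact le_max_of_le_right ((one_le_inv₀ hq).2 h)
  exact ⟨(add_le_add h1.1 h2.1).trans_eq (mul_add _ _ _).symm,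
    (add_le_add h1.2 h2.2).trans_eq (mul_add _ _ _).symm⟩

/-! ### The profile replacing the difference of powers. -/

/-- The profile `A^{-m} (1 ∧ B/A)`, to which `A^{-m} - (A + B)^{-m}` is comparable. -/
def greenProfile (m B A : ℝ) : ℝ≥0∞ := ENNReal.ofReal (A ^ (-m) * (B / max B A))

theorem antitoneOn_greenProfile {m B : ℝ} (hm : 0 < m) (hB : 0 < B) :
    AntitoneOn (greenProfile m B) (Ioi 0) := by
  intro A hA A' hA' h
  have hA : 0 < A := hA
  have hA' : 0 < A' := hA'
  refine ENNReal.ofReal_le_ofReal ?_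
  have := Real.rpow_le_rpow_of_nonpos hA h (show -m ≤ 0 by linarith)
  gcongr

theorem greenProfile_le_two_mul {m B A : ℝ} (hB : 0 < B) (hA : 0 < A) :
    greenProfile m B A ≤ ENNReal.ofReal (2 ^ (m + 1)) * greenProfile m B (2 * A) := by
  rw [greenProfile, greenProfile, ← ENNReal.ofReal_mul (by positivity)]
  refine ENNReal.ofReal_le_ofReal ?_
  have h1 : (2 : ℝ) ^ (m + 1) * (2 * A) ^ (-m) = 2 * A ^ (-m) := by
    rw [Real.mul_rpow (by norm_num) hA.le, ← mul_assoc, ← Real.rpow_add (by norm_num)]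
    norm_num
  have h2 : max B (2 * A) ≤ 2 * max B A := by
    refine max_le ?_ ?_
    · linarith [le_max_left B A]
    · linarith [le_max_right B A]
  have h3 : B / max B A ≤ 2 * (B / max B (2 * A)) := by
    rw [← mul_div_assoc, div_le_div_iff₀ (by positivity) (by positivity)]
    nlinarith
  have h4 : 0 < A ^ (-m) := Real.rpow_pos_of_pos hA _
  calc A ^ (-m) * (B / max B A) ≤ A ^ (-m) * (2 * (B / max B (2 * A))) := by gcongr
    _ = (2 * A ^ (-m)) * (B / max B (2 * A)) := by ring
    _ = _ := by rw [← h1]; ring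

theorem one_sub_rpow_le {m t : ℝ} (hm : 0 < m) (ht : 0 < t) :
    1 - (1 + t) ^ (-m) ≤ m * t := by
  rw [Real.rpow_def_of_pos (by linarith)]
  have h1 := Real.add_one_le_exp (Real.log (1 + t) * -m)
  have h2 := Real.log_le_sub_one_of_pos (show 0 < 1 + t by linarith)
  nlinarith

/-- Let u = 1 ∧ t. Then log(1+t) ≥ t/(1+t) ≥ u/2, so (1+t)^{−m} ≤ 1/(1 + mu/2), and u ≤ 1 turns 1
minus this into at least mu/(2+m). -/
theorem le_one_sub_rpow {m t : ℝ} (hm : 0 < m) (ht : 0 < t) :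
    t / max t 1 ≤ (2 + m) / m * (1 - (1 + t) ^ (-m)) := by
  have hM : 0 < max t 1 := lt_max_of_lt_left ht
  set u := t / max t 1 with hu
  have hu0 : 0 < u := div_pos ht hM
  have hu1 : u ≤ 1 := (div_le_one hM).2 (le_max_left _ _)
  have hL : u / 2 ≤ Real.log (1 + t) := by
    refine le_trans ?_ (Real.one_sub_inv_le_log_of_pos (show 0 < 1 + t by linarith))
    have : 1 - (1 + t)⁻¹ = t / (1 + t) := by field_simp; ring
    rw [this, hu, div_div, div_le_div_iff₀ (by positivity) (by positivity)]
    have := le_max_left t 1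
    have := le_max_right t 1
    nlinarith
  have hmL : 0 < m * Real.log (1 + t) := mul_pos hm (by linarith)
  have hexp : (1 + t) ^ (-m) ≤ (1 + m * (u / 2))⁻¹ := by
    rw [Real.rpow_def_of_pos (by linarith), mul_neg, Real.exp_neg]
    refine inv_anti₀ (by positivity) ?_
    have := Real.add_one_le_exp (Real.log (1 + t) * m)
    nlinarith
  have h3 : m * u / (2 + m) ≤ 1 - (1 + m * (u / 2))⁻¹ := by
    have : 1 - (1 + m * (u / 2))⁻¹ = m * u / (2 + m * u) := by field_simp; ring
    rw [this]
    gcongr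
    nlinarith
  calc u = (2 + m) / m * (m * u / (2 + m)) := by field_simp
    _ ≤ _ := by gcongr; linarith

/-- Factoring out A^{−m} leaves 1 − (1+B'/A)^{−m}, which behaves like 1 ∧ B/A. The slack B ≤ B' ≤ 4B
allows δ(x)δ(y) to stand in for (1−|x|²)(1−|y|²). -/
theorem exists_comparable_greenProfile {m : ℝ} (hm : 0 < m) :
    ∃ C : ℝ, 0 < C ∧ ∀ A B B' : ℝ, 0 < A → 0 < B → B ≤ B' → B' ≤ 4 * B →
      Comparable C (ENNReal.ofReal A ^ (-m) - ENNReal.ofReal (A + B') ^ (-m))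
        (greenProfile m B A) := by
  refine ⟨(1 + 4 * m) + (2 + m) / m, by positivity, fun A B B' hA hB hBB hBB' => ?_⟩
  rw [ENNReal.ofReal_rpow_of_pos hA, ENNReal.ofReal_rpow_of_pos (by linarith),
    ← ENNReal.ofReal_sub _ (Real.rpow_nonneg (by linarith) _), greenProfile]
  have hA' : 0 < A ^ (-m) := Real.rpow_pos_of_pos hA _
  have hfac : ∀ b : ℝ, 0 < b → A ^ (-m) - (A + b) ^ (-m) =
      A ^ (-m) * (1 - (1 + b / A) ^ (-m)) := by
    intro b hb
    have : A + b = A * (1 + b / A) := by field_simp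
    rw [this, Real.mul_rpow hA.le (by positivity)]; ring
  have hpr : B / max B A = B / A / max (B / A) 1 := by
    rw [div_div, mul_max_of_nonneg _ _ hA.le]
    congr 2 <;> field_simp
  set t := B / A
  set t' := B' / A
  have ht : 0 < t := div_pos hB hA
  have htt : t ≤ t' := by simp only [t, t']; gcongr
  have htt' : t' ≤ 4 * t := by
    simp only [t, t']; rw [← mul_div_assoc]; gcongr
  have hM : 0 < max t 1 := lt_max_of_lt_left ht
  have hu0 : 0 < t / max t 1 := div_pos ht hM
  rw [hfac B' (by linarith), hpr]
  have hg : 0 < (1 + t') ^ (-m) := Real.rpow_pos_of_pos (by linarith) _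
  have hup : 1 - (1 + t') ^ (-m) ≤ (1 + 4 * m) * (t / max t 1) := by
    rcases le_total t 1 with h | h
    · rw [max_eq_right h, div_one]
      have := one_sub_rpow_le hm (ht.trans_le htt)
      nlinarith
    · rw [max_eq_left h, div_self ht.ne']
      linarith
  have hlow : t / max t 1 ≤ (2 + m) / m * (1 - (1 + t') ^ (-m)) := by
    refine (le_one_sub_rpow hm ht).trans ?_
    have := Real.rpow_le_rpow_of_nonpos (show 0 < 1 + t by linarith)
      (show 1 + t ≤ 1 + t' by linarith) (show -m ≤ 0 by linarith)
    gcongr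
  have hc : 0 < (2 + m) / m := by positivity
  have hg0 : 0 < 1 - (1 + t') ^ (-m) := by
    by_contra hcon
    nlinarith
  refine Comparable.ofReal (by positivity) ?_ ?_
  · calc A ^ (-m) * (1 - (1 + t') ^ (-m)) ≤ A ^ (-m) * ((1 + 4 * m) * (t / max t 1)) := by gcongr
      _ ≤ A ^ (-m) * (((1 + 4 * m) + (2 + m) / m) * (t / max t 1)) :=
        mul_le_mul_of_nonneg_left (mul_le_mul_of_nonneg_right (by linarith) hu0.le) hA'.le
      _ = _ := by ring
  · calc A ^ (-m) * (t / max t 1) ≤ A ^ (-m) * ((2 + m) / m * (1 - (1 + t') ^ (-m))) := by gcongr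
      _ ≤ A ^ (-m) * (((1 + 4 * m) + (2 + m) / m) * (1 - (1 + t') ^ (-m))) := by gcongr; linarith
      _ = _ := by ring

/-! ### Power integrals with a cut-off at B. -/

theorem lintegral_rpow_Ioc {p a b : ℝ} (hp : -1 < p) (ha : 0 ≤ a) (hab : a ≤ b) :
    ∫⁻ w in Ioc a b, ENNReal.ofReal (w ^ p) =
      ENNReal.ofReal ((b ^ (p + 1) - a ^ (p + 1)) / (p + 1)) := by
  have h := (intervalIntegrable_iff_integrableOn_Ioc_of_le hab).1
    (intervalIntegral.intervalIntegrable_rpow' (a := a) (b := b) hp)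
  rw [← ofReal_integral_eq_lintegral_ofReal h, ← intervalIntegral.integral_of_le hab,
    integral_rpow (Or.inl hp)]
  exact (ae_restrict_iff' measurableSet_Ioc).2
    (Filter.Eventually.of_forall fun v hv => Real.rpow_nonneg (ha.trans hv.1.le) _)

theorem lintegral_rpow_Ioc_le {p a : ℝ} (hp : p < -1) (ha : 0 < a) (b : ℝ) :
    ∫⁻ w in Ioc a b, ENNReal.ofReal (w ^ p) ≤ ENNReal.ofReal (a ^ (p + 1) / (-p - 1)) := by
  have h := integral_Ioi_rpow_of_lt hp ha
  refine (lintegral_mono_set Ioc_subset_Ioi_self).trans_eq ?_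
  rw [← ofReal_integral_eq_lintegral_ofReal (integrableOn_Ioi_rpow_of_lt hp ha), h]
  · congr 1
    rw [← neg_div_neg_eq]
    congr 1 <;> ring
  · exact (ae_restrict_iff' measurableSet_Ioi).2
      (Filter.Eventually.of_forall fun v hv => Real.rpow_nonneg (ha.le.trans (le_of_lt hv)) _)

theorem lintegral_inv_Ioc {a b : ℝ} (ha : 0 < a) (hab : a ≤ b) :
    ∫⁻ w in Ioc a b, ENNReal.ofReal (w ^ (-1 : ℝ)) = ENNReal.ofReal (Real.log (b / a)) := by
  have h0 : (0 : ℝ) ∉ uIcc a b := by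
    rw [uIcc_of_le hab]; exact fun h => absurd h.1 (by linarith)
  have h := (intervalIntegrable_iff_integrableOn_Ioc_of_le hab).1
    (intervalIntegral.intervalIntegrable_rpow (a := a) (b := b) (r := -1) (μ := volume) (Or.inr h0))
  rw [← ofReal_integral_eq_lintegral_ofReal h, ← intervalIntegral.integral_of_le hab]
  · simp only [Real.rpow_neg_one]
    rw [integral_inv_of_pos ha (by linarith)]
  · exact (ae_restrict_iff' measurableSet_Ioc).2
      (Filter.Eventually.of_forall fun v hv => Real.rpow_nonneg (ha.le.trans hv.1.le) _)

/-- `∫_ε^D w^{-ν-1} (1 ∧ B/w) dw`. -/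
def tailIntegral (ν B ε D : ℝ) : ℝ≥0∞ :=
  ∫⁻ w in Ioc ε D, ENNReal.ofReal (w ^ (-ν - 1) * (B / max B w))

/-- The cut-off becomes active at w = B; clamping B to [ε, D] covers every order of the three
numbers in one formula. -/
theorem tailIntegral_eq {ν B ε D : ℝ} (hB : 0 < B) (hε : 0 ≤ ε) (hD : ε ≤ D) :
    tailIntegral ν B ε D =
      (∫⁻ w in Ioc ε (max ε (min B D)), ENNReal.ofReal (w ^ (-ν - 1))) +
        ENNReal.ofReal B * ∫⁻ w in Ioc (max ε (min B D)) D, ENNReal.ofReal (w ^ (-ν - 2)) := by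
  rw [tailIntegral, ← Ioc_union_Ioc_eq_Ioc (le_max_left ε (min B D)) (max_le hD (min_le_right _ _)),
    lintegral_union measurableSet_Ioc (Ioc_disjoint_Ioc_of_le le_rfl),
    ← lintegral_const_mul' _ _ ENNReal.ofReal_ne_top]
  congr 1
  · refine setLIntegral_congr_fun measurableSet_Ioc fun w hw => ?_
    have h : w ≤ B := by
      rcases le_max_iff.1 hw.2 with h | h
      · exact absurd hw.1 (by linarith)
      · exact h.trans (min_le_left _ _)
    simp only [max_eq_left h, div_self hB.ne', mul_one]
  · refine setLIntegral_congr_fun measurableSet_Ioc fun w hw => ?_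
    have h : B ≤ w := by
      have h1 : min B D < w := (le_max_right _ _).trans_lt hw.1
      rcases min_lt_iff.1 h1 with h | h
      · exact h.le
      · exact absurd hw.2 (by linarith)
    have hw0 : 0 < w := (hε.trans (le_max_left _ _)).trans_lt hw.1
    have e : w ^ (-ν - 1) = w ^ (-ν - 2) * w := by
      nth_rewrite 3 [← Real.rpow_one w]
      rw [← Real.rpow_add hw0]; congr 1; ring
    simp only [max_eq_right h]
    rw [← ENNReal.ofReal_mul hB.le, e]
    congr 1
    field_simp

theorem tailIntegral_eq_top {ν B D : ℝ} (hν : 0 ≤ ν) (hB : 0 < B) (hD : 0 < D) :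
    tailIntegral ν B 0 D = ⊤ := by
  have hβ : 0 < min B D := lt_min hB hD
  rw [tailIntegral_eq hB le_rfl hD.le, max_eq_right hβ.le]
  refine ENNReal.add_eq_top.2 (Or.inl ?_)
  by_contra h
  have h1 : IntegrableOn (fun t : ℝ => t ^ (-ν - 1)) (Ioc 0 (min B D)) := by
    refine (lintegral_ofReal_ne_top_iff_integrable ?_ ?_).1 h
    · exact Measurable.aestronglyMeasurable (by fun_prop)
    · exact (ae_restrict_iff' measurableSet_Ioc).2
        (Filter.Eventually.of_forall fun t ht => Real.rpow_nonneg ht.1.le _)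
  have := (intervalIntegral.integrableOn_Ioo_rpow_iff hβ).1 (h1.mono_set Ioo_subset_Ioc_self)
  linarith

/-- Integrals dominated by the lower endpoint. -/
theorem comparable_tail_of_pos {ν : ℝ} (hν : 0 < ν) {B ε : ℝ} (hB : 0 < B) (hε : 0 < ε) (D : ℝ) :
    Comparable (1 + ν⁻¹)
      (ENNReal.ofReal (ε ^ (-ν) * (B / max B ε)) + tailIntegral ν B ε D)
      (ENNReal.ofReal (ε ^ (-ν) * (B / max B ε))) := by
  have hM : 0 < max B ε := lt_max_of_lt_left hB
  -- Freeze the decreasing cut-off factor at w = ε and extend the power integral to infinity.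
  have hup : tailIntegral ν B ε D ≤ ENNReal.ofReal (ν⁻¹ * (ε ^ (-ν) * (B / max B ε))) := by
    calc tailIntegral ν B ε D
        ≤ ∫⁻ w in Ioc ε D, ENNReal.ofReal (B / max B ε) * ENNReal.ofReal (w ^ (-ν - 1)) := by
          refine setLIntegral_mono' measurableSet_Ioc fun w hw => ?_
          have hw0 : 0 < w := hε.trans hw.1
          rw [← ENNReal.ofReal_mul (by positivity), mul_comm]
          refine ENNReal.ofReal_le_ofReal ?_
          gcongr
          exact hw.1.le
      _ ≤ ENNReal.ofReal (B / max B ε) * ENNReal.ofReal (ε ^ (-ν - 1 + 1) / (-(-ν - 1) - 1)) := by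
          rw [lintegral_const_mul' _ _ ENNReal.ofReal_ne_top]
          gcongr
          exact lintegral_rpow_Ioc_le (by linarith) hε D
      _ = _ := by
          rw [← ENNReal.ofReal_mul (by positivity)]
          congr 1
          rw [show -ν - 1 + 1 = -ν by ring, show -(-ν - 1) - 1 = ν by ring]
          field_simp
  refine ⟨?_, ?_⟩
  · refine (add_le_add_right hup _).trans_eq ?_
    rw [← ENNReal.ofReal_add (by positivity) (by positivity),
      ← ENNReal.ofReal_mul (by positivity)]
    congr 1; ring
  · calc ENNReal.ofReal (ε ^ (-ν) * (B / max B ε))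
        = ENNReal.ofReal 1 * ENNReal.ofReal (ε ^ (-ν) * (B / max B ε)) := by simp
      _ ≤ _ := by
        gcongr
        · have : 0 < ν⁻¹ := inv_pos.2 hν
          linarith
        · exact le_self_add

/-- Bounded factors are absorbed by 1 ∨ log, since log 8 ≤ 3. This permits replacing D by (D−ε)/4,
which is |x₁y₁| in the application. -/
theorem log_div_le_of_le_eight_mul_max {X Y Z : ℝ} (hX : 0 < X) (hY : 0 < Y)
    (h : X ≤ 8 * max Y Z) : Real.log (X / Y) ≤ 4 * max 1 (Real.log (Z / Y)) := by
  have h8 : Real.log 8 ≤ 3 := by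
    rw [show (8 : ℝ) = 2 ^ 3 by norm_num, Real.log_pow]
    have := Real.log_two_lt_d9
    push_cast; linarith
  have h1 := le_max_left 1 (Real.log (Z / Y))
  have h2 := le_max_right 1 (Real.log (Z / Y))
  rcases le_total Z Y with hZ | hZ
  · rw [max_eq_left hZ] at h
    have : Real.log (X / Y) ≤ Real.log 8 :=
      Real.log_le_log (by positivity) ((div_le_iff₀ hY).2 h)
    linarith
  · rw [max_eq_right hZ] at h
    have hZ0 : 0 < Z := hY.trans_le hZ
    have : Real.log (X / Y) ≤ Real.log (8 * (Z / Y)) :=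
      Real.log_le_log (by positivity) (by rw [← mul_div_assoc]; gcongr)
    rw [Real.log_mul (by norm_num) (by positivity)] at this
    linarith

theorem log_div_le_log_div {X Y Z : ℝ} (hZ : 0 ≤ Z) (hY : 0 < Y) (hYX : Y ≤ X) (hZX : Z ≤ X) :
    Real.log (Z / Y) ≤ Real.log (X / Y) := by
  rcases hZ.eq_or_lt with rfl | hZ
  -- Here Z = 0 and `Real.log 0 = 0`, so Y ≤ X is what makes the inequality true.
  · simpa using Real.log_nonneg ((one_le_div hY).2 hYX)
  · exact Real.log_le_log (by positivity) (by gcongr)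

/-- The logarithmic integral. -/
theorem comparable_tail_zero {B ε D : ℝ} (hB : 0 < B) (hε : 0 < ε) (hD : ε ≤ D) :
    Comparable 6 (ENNReal.ofReal (B / max B ε) + tailIntegral 0 B ε D)
      (ENNReal.ofReal (B / max B ε * max 1 (Real.log (min ((D - ε) / 4) B / ε)))) := by
  have hM : 0 < max B ε := lt_max_of_lt_left hB
  have hD0 : 0 < D := hε.trans_le hD
  set β := max ε (min B D) with hβ
  have hβε : ε ≤ β := le_max_left _ _
  have hβ0 : 0 < β := hε.trans_le hβε
  set R := max 1 (Real.log (min ((D - ε) / 4) B / ε)) with hR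
  have hR1 : 1 ≤ R := le_max_left _ _
  have hu : 0 < B / max B ε := by positivity
  have hlog0 : 0 ≤ Real.log (β / ε) := Real.log_nonneg ((one_le_div hε).2 hβε)
  have heq := tailIntegral_eq (ν := 0) hB hε.le hD
  rw [← hβ, show -(0 : ℝ) - 1 = -1 by ring, lintegral_inv_Ioc hε hβε] at heq
  have hlog : Real.log (β / ε) ≤ 4 * (B / max B ε * R) := by
    rcases le_total B ε with h | h
    · have : β = ε := max_eq_left ((min_le_left _ _).trans h)
      rw [this, div_self hε.ne', Real.log_one]; positivity
    · rw [max_eq_left h, div_self hB.ne', one_mul]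
      refine log_div_le_of_le_eight_mul_max hβ0 hε ?_
      -- If D ≥ 2ε then D ≤ 8·(D−ε)/4; otherwise D is already at most 2ε. This is the source of the
      -- factor 8.
      rcases le_total D (2 * ε) with h2 | h2
      · refine max_le ?_ ?_
        · linarith [le_max_left ε (min ((D - ε) / 4) B)]
        · linarith [le_max_left ε (min ((D - ε) / 4) B), min_le_right B D]
      · refine max_le ?_ ?_
        · linarith [le_max_left ε (min ((D - ε) / 4) B)]
        · have h3 := le_max_right ε (min ((D - ε) / 4) B)
          have h4 : min B D ≤ 8 * min ((D - ε) / 4) B := by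
            rcases min_cases ((D - ε) / 4) B with ⟨e, _⟩ | ⟨e, _⟩ <;> rw [e]
            · linarith [min_le_right B D]
            · linarith [min_le_left B D]
          linarith
  have htail : ENNReal.ofReal B * ∫⁻ w in Ioc β D, ENNReal.ofReal (w ^ (-(0 : ℝ) - 2)) ≤
      ENNReal.ofReal (B / max B ε) := by
    rcases le_total D B with h | h
    · have : β = D := by rw [hβ, min_eq_right h, max_eq_right hD]
      simp [this]
    · have : β = max B ε := by rw [hβ, min_eq_left h, max_comm]
      rw [div_eq_mul_inv, ENNReal.ofReal_mul hB.le]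
      gcongr
      refine (lintegral_rpow_Ioc_le (by norm_num) hβ0 D).trans (ENNReal.ofReal_le_ofReal ?_)
      rw [this]
      norm_num [Real.rpow_neg_one]
  rw [heq]
  refine ⟨?_, ?_⟩
  · calc _ ≤ ENNReal.ofReal (B / max B ε) + (ENNReal.ofReal (4 * (B / max B ε * R)) +
          ENNReal.ofReal (B / max B ε)) := by gcongr
      _ ≤ _ := by
        rw [← ENNReal.ofReal_add (by positivity) (by positivity),
          ← ENNReal.ofReal_add (by positivity) (by positivity), ← ENNReal.ofReal_mul (by norm_num)]
        refine ENNReal.ofReal_le_ofReal ?_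
        nlinarith
  · have h1 : B / max B ε * R ≤ 6 * (B / max B ε + Real.log (β / ε)) := by
      rcases le_total (Real.log (min ((D - ε) / 4) B / ε)) 1 with h | h
      · rw [hR, max_eq_left h]; linarith
      · have hq : B / max B ε ≤ 1 := (div_le_one hM).2 (le_max_left _ _)
        have h2 : Real.log (min ((D - ε) / 4) B / ε) ≤ Real.log (β / ε) := by
          refine log_div_le_log_div (le_min (by linarith) hB.le) hε hβε ?_
          refine le_max_of_le_right (le_min (min_le_right _ _) ((min_le_left _ _).trans ?_))
          linarith
        rw [hR, max_eq_right h]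
        nlinarith
    calc _ ≤ ENNReal.ofReal (6 * (B / max B ε + Real.log (β / ε))) := ENNReal.ofReal_le_ofReal h1
      _ = ENNReal.ofReal 6 * (ENNReal.ofReal (B / max B ε) + ENNReal.ofReal (Real.log (β / ε))) := by
        rw [ENNReal.ofReal_mul (by norm_num), ENNReal.ofReal_add hu.le hlog0]
      _ ≤ _ := by gcongr; exact le_self_add

/-- Growth is at the upper end until the cut-off: the value is about √D if D ≤ B and about B/√(B ∨
ε) otherwise. The product on the right records both regimes. -/
theorem comparable_tail_neg_half {B ε D : ℝ} (hB : 0 < B) (hε : 0 ≤ ε) (hD : ε ≤ D) (hD0 : 0 < D) :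
    Comparable 6 (ENNReal.ofReal (√ε * (B / max B ε)) + tailIntegral (-1 / 2) B ε D)
      (ENNReal.ofReal (min √D √B * (√B / max √B √ε))) := by
  have hsε := Real.sqrt_nonneg ε
  have hsB := Real.sqrt_pos.2 hB
  have hsD := Real.sqrt_pos.2 hD0
  have hεD := Real.sqrt_le_sqrt hD
  have heq := tailIntegral_eq (ν := -1 / 2) hB hε hD
  set β := max ε (min B D) with hβ
  have hβε : ε ≤ β := le_max_left _ _
  have hβ0 : 0 < β := lt_max_of_lt_right (lt_min hB hD0)
  have hεβ := Real.sqrt_le_sqrt hβε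
  have hP : ∫⁻ w in Ioc ε β, ENNReal.ofReal (w ^ (-(-1 / 2 : ℝ) - 1)) =
      ENNReal.ofReal (2 * (√β - √ε)) := by
    rw [lintegral_rpow_Ioc (by norm_num) hε hβε, Real.sqrt_eq_rpow, Real.sqrt_eq_rpow]
    congr 1
    norm_num
    ring
  rw [hP] at heq
  rw [heq]
  have hfirst : 0 ≤ √ε * (B / max B ε) := by positivity
  have hsub : 0 ≤ 2 * (√β - √ε) := by linarith
  rcases le_total D B with h | h
  · have hβD : β = D := by rw [hβ, min_eq_right h, max_eq_right hD]
    have h2 : ε ≤ B := hD.trans h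
    rw [hβD] at hsub ⊢
    rw [Ioc_self, Measure.restrict_empty, lintegral_zero_measure, mul_zero, add_zero,
      ← ENNReal.ofReal_add hfirst hsub, max_eq_left h2, max_eq_left (Real.sqrt_le_sqrt h2),
      min_eq_left (Real.sqrt_le_sqrt h), div_self hB.ne', div_self hsB.ne']
    exact Comparable.ofReal (by norm_num) (by linarith) (by linarith)
  · have hβM : β = max ε B := by rw [hβ, min_eq_left h]
    have hQ : ∫⁻ w in Ioc β D, ENNReal.ofReal (w ^ (-(-1 / 2 : ℝ) - 2)) ≤
        ENNReal.ofReal (2 * (√β)⁻¹) := by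
      refine (lintegral_rpow_Ioc_le (by norm_num) hβ0 D).trans_eq ?_
      congr 1
      rw [Real.sqrt_eq_rpow, ← Real.rpow_neg hβ0.le]
      norm_num
      ring
    have hR : min √D √B * (√B / max √B √ε) = B / √β := by
      rw [min_eq_right (Real.sqrt_le_sqrt h), ← mul_div_assoc, Real.mul_self_sqrt hB.le, hβM]
      congr 1
      rcases le_total B ε with h3 | h3
      · rw [max_eq_left h3, max_eq_right (Real.sqrt_le_sqrt h3)]
      · rw [max_eq_right h3, max_eq_left (Real.sqrt_le_sqrt h3)]
    have hsβ := Real.sqrt_pos.2 hβ0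
    have hRpos : 0 < B / √β := by positivity
    have hmain : √ε * (B / max B ε) + 2 * (√β - √ε) ≤ 4 * (B / √β) ∧
        B / √β ≤ √ε * (B / max B ε) + 2 * (√β - √ε) := by
      rcases le_total B ε with h3 | h3
      · have e : β = ε := by rw [hβM, max_eq_left h3]
        rw [e] at hRpos ⊢
        have e2 : √ε * (B / max B ε) = B / √ε := by
          have hε0 : 0 < ε := hB.trans_le h3
          have := Real.sqrt_pos.2 hε0
          rw [max_eq_right h3]
          nth_rewrite 2 [← Real.mul_self_sqrt hε]
          field_simp
        rw [e2]
        constructor <;> linarith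
      · have e : β = B := by rw [hβM, max_eq_right h3]
        have e3 : B / √B = √B := Real.div_sqrt
        rw [e] at hεβ ⊢
        rw [max_eq_left h3, div_self hB.ne', e3]
        constructor <;> linarith
    rw [hR]
    refine ⟨?_, ?_⟩
    · calc _ ≤ ENNReal.ofReal (√ε * (B / max B ε)) + (ENNReal.ofReal (2 * (√β - √ε)) +
            ENNReal.ofReal B * ENNReal.ofReal (2 * (√β)⁻¹)) := by gcongr
        _ ≤ _ := by
          rw [← ENNReal.ofReal_mul hB.le, ← ENNReal.ofReal_add hsub (by positivity),
            ← ENNReal.ofReal_add hfirst (by positivity), ← ENNReal.ofReal_mul (by norm_num)]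
          refine ENNReal.ofReal_le_ofReal ?_
          have : B * (2 * (√β)⁻¹) = 2 * (B / √β) := by ring
          linarith [hmain.1]
    · calc _ ≤ ENNReal.ofReal 6 *
            ENNReal.ofReal (√ε * (B / max B ε) + 2 * (√β - √ε)) := by
            rw [← ENNReal.ofReal_mul (by norm_num)]
            refine ENNReal.ofReal_le_ofReal ?_
            linarith [hmain.2]
        _ ≤ _ := by
          rw [ENNReal.ofReal_add hfirst hsub]
          gcongr
          exact le_self_add

/-- The endpoint term and the integral below the cut-off add up to exactly D ∧ B. The logarithm
comes from w > B, where the integrand is B/w. -/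
theorem comparable_tail_neg_one {B ε D : ℝ} (hB : 0 < B) (hε : 0 ≤ ε) (hD : ε ≤ D) (hD0 : 0 < D) :
    Comparable 6 (ENNReal.ofReal (ε * (B / max B ε)) + tailIntegral (-1) B ε D)
      (ENNReal.ofReal (min D B * max 1 (Real.log ((D - ε) / 4 / max B ε)))) := by
  have heq := tailIntegral_eq (ν := -1) hB hε hD
  set β := max ε (min B D) with hβ
  have hβε : ε ≤ β := le_max_left _ _
  have hβD : β ≤ D := max_le hD (min_le_right _ _)
  have hβ0 : 0 < β := lt_max_of_lt_right (lt_min hB hD0)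
  have hlog0 : 0 ≤ Real.log (D / β) := Real.log_nonneg ((one_le_div hβ0).2 hβD)
  have hP : ∫⁻ w in Ioc ε β, ENNReal.ofReal (w ^ (-(-1 : ℝ) - 1)) = ENNReal.ofReal (β - ε) := by
    rw [lintegral_rpow_Ioc (by norm_num) hε hβε]
    norm_num
  rw [hP, show -(-1 : ℝ) - 2 = -1 by norm_num, lintegral_inv_Ioc hβ0 hβD] at heq
  have hfirst : 0 ≤ ε * (B / max B ε) := by positivity
  rw [heq, ← ENNReal.ofReal_mul hB.le, ← ENNReal.ofReal_add (by linarith) (by positivity),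
    ← ENNReal.ofReal_add hfirst (add_nonneg (by linarith) (by positivity))]
  rcases le_total D B with h | h
  · have e : β = D := by rw [hβ, min_eq_right h, max_eq_right hD]
    have h2 : ε ≤ B := hD.trans h
    have hl : Real.log ((D - ε) / 4 / B) ≤ 0 := by
      refine Real.log_nonpos (div_nonneg (by linarith) hB.le) ((div_le_one hB).2 (by linarith))
    rw [e, max_eq_left h2, div_self hB.ne', div_self hD0.ne', Real.log_one, min_eq_left h,
      max_eq_left (hl.trans zero_le_one)]
    exact Comparable.ofReal (by norm_num) (by linarith) (by linarith)
  · have e : β = max B ε := by rw [hβ, min_eq_left h, max_comm]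
    have e2 : ε * (B / max B ε) + (β - ε) = B := by
      rw [e]
      rcases le_total B ε with h3 | h3
      · have : 0 < ε := hB.trans_le h3
        rw [max_eq_right h3]; field_simp; ring
      · rw [max_eq_left h3, div_self hB.ne']; ring
    rw [← add_assoc, e2, min_eq_right h, ← e]
    have h1 : Real.log (D / β) ≤ 4 * max 1 (Real.log ((D - ε) / 4 / β)) := by
      refine log_div_le_of_le_eight_mul_max hD0 hβ0 ?_
      rcases le_total D (2 * ε) with h2 | h2
      · linarith [le_max_left β ((D - ε) / 4)]
      · linarith [le_max_right β ((D - ε) / 4)]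
    have h2 : Real.log ((D - ε) / 4 / β) ≤ Real.log (D / β) :=
      log_div_le_log_div (by linarith) hβ0 hβD (by linarith)
    have h3 := le_max_left 1 (Real.log ((D - ε) / 4 / β))
    refine Comparable.ofReal (by norm_num) ?_ ?_
    · nlinarith
    · have h4 : max 1 (Real.log ((D - ε) / 4 / β)) ≤ 1 + Real.log (D / β) :=
        max_le (by linarith) (by linarith)
      nlinarith

/-! ### Reduction of the Green function to tail integrals. -/

section Green

theorem Comparable.eq_top {C : ℝ} {f : ℝ≥0∞} (H : Comparable C f ⊤) : f = ⊤ := by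
  by_contra h
  exact absurd H.2 (not_le.2 (ENNReal.mul_lt_top ENNReal.ofReal_lt_top (lt_top_iff_ne_top.2 h)))

theorem Comparable.top {C : ℝ} (hC : 0 < C) : Comparable C ⊤ ⊤ := by
  have : ENNReal.ofReal C * ⊤ = ⊤ := ENNReal.mul_top (ENNReal.ofReal_pos.2 hC).ne'
  exact ⟨this.ge, this.ge⟩

theorem lintegral_Ioo_eq_one_sub (F : ℝ → ℝ≥0∞) :
    ∫⁻ s in Ioo (-1 : ℝ) 1, F s = ENNReal.ofReal 2 * ∫⁻ v in Ioo (0 : ℝ) 1, F (1 - 2 * v) := by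
  have hi : (fun t : ℝ => 1 - 2 * t) '' Ioo (0 : ℝ) 1 = Ioo (-1) 1 := by
    ext s
    simp only [mem_image, mem_Ioo]
    exact ⟨fun ⟨u, hu, h⟩ => ⟨by linarith, by linarith⟩,
      fun h => ⟨(1 - s) / 2, ⟨by linarith, by linarith⟩, by ring⟩⟩
  have h := lintegral_image_eq_lintegral_abs_deriv_mul (s := Ioo (0 : ℝ) 1)
    (f := fun t => 1 - 2 * t) (f' := fun _ => -2) measurableSet_Ioo
    (fun t _ => by simpa using (((hasDerivAt_id t).const_mul 2).const_sub 1).hasDerivWithinAt)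
    (fun t _ u _ h => by simp only at h; linarith) F
  rw [hi] at h
  rw [h, ← lintegral_const_mul' _ _ ENNReal.ofReal_ne_top]
  norm_num

theorem lintegral_Ioo_eq_sub_one (F : ℝ → ℝ≥0∞) :
    ∫⁻ s in Ioo (-1 : ℝ) 1, F s = ENNReal.ofReal 2 * ∫⁻ v in Ioo (0 : ℝ) 1, F (2 * v - 1) := by
  have hi : (fun t : ℝ => 2 * t - 1) '' Ioo (0 : ℝ) 1 = Ioo (-1) 1 := by
    ext s
    simp only [mem_image, mem_Ioo]
    exact ⟨fun ⟨u, hu, h⟩ => ⟨by linarith, by linarith⟩,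
      fun h => ⟨(s + 1) / 2, ⟨by linarith, by linarith⟩, by ring⟩⟩
  have h := lintegral_image_eq_lintegral_abs_deriv_mul (s := Ioo (0 : ℝ) 1)
    (f := fun t => 2 * t - 1) (f' := fun _ => 2) measurableSet_Ioo
    (fun t _ => by simpa using (((hasDerivAt_id t).const_mul 2).sub_const 1).hasDerivWithinAt)
    (fun t _ u _ h => by simp only at h; linarith) F
  rw [hi] at h
  rw [h, ← lintegral_const_mul' _ _ ENNReal.ofReal_ne_top]
  norm_num

theorem jacobiWeight_one_sub (k : ℝ) {v : ℝ} (hv : v ∈ Ioo (0 : ℝ) 1) :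
    jacobiWeight k (1 - 2 * v) = 2 ^ (k - 1) * 2 ^ k * (v ^ (k - 1) * (1 - v) ^ (k + 1 - 1)) := by
  rw [jacobiWeight, show 1 - (1 - 2 * v) = 2 * v by ring,
    show 1 + (1 - 2 * v) = 2 * (1 - v) by ring, Real.mul_rpow (by norm_num) hv.1.le,
    Real.mul_rpow (by norm_num) (by linarith [hv.2]), add_sub_cancel_right]
  ring

theorem jacobiWeight_sub_one (k : ℝ) {v : ℝ} (hv : v ∈ Ioo (0 : ℝ) 1) :
    jacobiWeight k (2 * v - 1) = 2 ^ (k - 1) * 2 ^ k * (v ^ (k + 1 - 1) * (1 - v) ^ (k - 1)) := by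
  rw [jacobiWeight, show 1 - (2 * v - 1) = 2 * (1 - v) by ring,
    show 1 + (2 * v - 1) = 2 * v by ring, Real.mul_rpow (by norm_num) hv.1.le,
    Real.mul_rpow (by norm_num) (by linarith [hv.2]), add_sub_cancel_right]
  ring

variable {d : ℕ} [NeZero d]

/-- The product `δ(x) δ(y)` as a real number. -/
def bdryProd {d : ℕ} (x y : EuclideanSpace ℝ (Fin d)) : ℝ := (1 - ‖x‖) * (1 - ‖y‖)

theorem bdryProd_pos {d : ℕ} {x y : EuclideanSpace ℝ (Fin d)} (hx : ‖x‖ < 1) (hy : ‖y‖ < 1) :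
    0 < bdryProd x y := mul_pos (by linarith) (by linarith)

theorem ballFactor_bounds {d : ℕ} {x y : EuclideanSpace ℝ (Fin d)} (hx : ‖x‖ < 1) (hy : ‖y‖ < 1) :
    bdryProd x y ≤ ballFactor x y ∧ ballFactor x y ≤ 4 * bdryProd x y := by
  have h0 := bdryProd_pos hx hy
  have h1 : ballFactor x y = bdryProd x y * ((1 + ‖x‖) * (1 + ‖y‖)) := by
    rw [ballFactor, bdryProd]; ring
  have hx0 := norm_nonneg x
  have hy0 := norm_nonneg y
  have h2 : (1 + ‖x‖) * (1 + ‖y‖) ≤ 2 * 2 := by gcongr <;> linarith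
  rw [h1]
  constructor <;> nlinarith [mul_nonneg hx0 hy0]

theorem exists_comparable_green_profile {k : ℝ} (hk : 0 < k) (hm : 0 < k + (d : ℝ) / 2 - 1) :
    ∃ C : ℝ, 0 < C ∧ ∀ x y : EuclideanSpace ℝ (Fin d), ‖x‖ < 1 → ‖y‖ < 1 →
      (0 < ‖x - y‖ ∨ 0 < ‖x - reflect y‖) →
      Comparable C (greenFunction k x y) (∫⁻ s in Ioo (-1 : ℝ) 1,
        greenProfile (k + (d : ℝ) / 2 - 1) (bdryProd x y) (sqDistInterp x y s) *
          ENNReal.ofReal (jacobiWeight k s)) := by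
  obtain ⟨C, hC, H⟩ := exists_comparable_greenProfile hm
  set N := (newtonConst d k).toReal with hN
  have hN0 : 0 < N := ENNReal.toReal_pos (newtonConst_ne_zero hk) (newtonConst_ne_top hm)
  have hNe : newtonConst d k = ENNReal.ofReal N := (ENNReal.ofReal_toReal (newtonConst_ne_top hm)).symm
  refine ⟨max N N⁻¹ * C, by positivity, fun x y hx hy hxy => ?_⟩
  rw [greenFunction_eq_lintegral hk hm hx hy, hNe]
  refine (Comparable.const_mul hN0 _).trans (by positivity) ?_
  refine Comparable.setLIntegral measurableSet_Ioo fun s hs => Comparable.mul_right ?_ _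
  have h1 : 0 < (1 + s) / 2 := by linarith [hs.1]
  have h2 : 0 < (1 - s) / 2 := by linarith [hs.2]
  refine H _ _ _ ?_ (bdryProd_pos hx hy) (ballFactor_bounds hx hy).1 (ballFactor_bounds hx hy).2
  unfold sqDistInterp
  rcases hxy with h | h <;> positivity

/-- The substitutions s = 1−2v and s = 2v−1 put the nearer singularity at v = 0. The weight has
exponent k−1 at s = 1 and k at s = −1, hence q = k on the same side and q = k+1 on opposite sides.
-/
theorem exists_comparable_green_affine {k : ℝ} (hk : 0 < k) (hm : 0 < k + (d : ℝ) / 2 - 1) :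
    ∃ C : ℝ, 0 < C ∧ ∀ x y : EuclideanSpace ℝ (Fin d), ‖x‖ < 1 → ‖y‖ < 1 →
      (0 ≤ x 0 * y 0 → 0 < ‖x - reflect y‖ → Comparable C (greenFunction k x y)
        (ENNReal.ofReal ((‖x - reflect y‖ ^ 2) ^ (-k)) *
          (greenProfile (k + (d : ℝ) / 2 - 1) (bdryProd x y) (‖x - y‖ ^ 2) *
            ENNReal.ofReal ((‖x - y‖ ^ 2) ^ k) +
          ∫⁻ w in Ioc (‖x - y‖ ^ 2) (‖x - reflect y‖ ^ 2),
            greenProfile (k + (d : ℝ) / 2 - 1) (bdryProd x y) w * ENNReal.ofReal (w ^ (k - 1))))) ∧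
      (x 0 * y 0 ≤ 0 → 0 < ‖x - y‖ → Comparable C (greenFunction k x y)
        (ENNReal.ofReal ((‖x - y‖ ^ 2) ^ (-(k + 1))) *
          (greenProfile (k + (d : ℝ) / 2 - 1) (bdryProd x y) (‖x - reflect y‖ ^ 2) *
            ENNReal.ofReal ((‖x - reflect y‖ ^ 2) ^ (k + 1)) +
          ∫⁻ w in Ioc (‖x - reflect y‖ ^ 2) (‖x - y‖ ^ 2),
            greenProfile (k + (d : ℝ) / 2 - 1) (bdryProd x y) w *
              ENNReal.ofReal (w ^ (k + 1 - 1))))) := by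
  set m := k + (d : ℝ) / 2 - 1 with hmdef
  obtain ⟨C₀, hC₀, H₀⟩ := exists_comparable_green_profile (d := d) hk hm
  have hK : (1 : ℝ) ≤ 2 ^ (m + 1) := Real.one_le_rpow (by norm_num) (by linarith)
  obtain ⟨C₁, hC₁, H₁⟩ := exists_comparable_lintegral_affine hk (show 0 < k + 1 by linarith) hK
  obtain ⟨C₂, hC₂, H₂⟩ := exists_comparable_lintegral_affine (show 0 < k + 1 by linarith) hk hK
  set N : ℝ := 2 * (2 ^ (k - 1) * 2 ^ k) with hN
  have hN0 : 0 < N := by positivity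
  have hCs : C₁ ≤ C₁ + C₂ ∧ C₂ ≤ C₁ + C₂ := ⟨by linarith, by linarith⟩
  refine ⟨C₀ * (max N N⁻¹ * (C₁ + C₂)), by positivity, fun x y hx hy => ⟨fun hxy h => ?_,
    fun hxy h => ?_⟩⟩
  · have hab := norm_sub_reflect_sq x y
    have e : ∫⁻ s in Ioo (-1 : ℝ) 1, greenProfile m (bdryProd x y) (sqDistInterp x y s) *
        ENNReal.ofReal (jacobiWeight k s) = ENNReal.ofReal N * ∫⁻ v in Ioo (0 : ℝ) 1,
          greenProfile m (bdryProd x y)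
            (‖x - y‖ ^ 2 + (‖x - reflect y‖ ^ 2 - ‖x - y‖ ^ 2) * v) *
          ENNReal.ofReal (v ^ (k - 1) * (1 - v) ^ (k + 1 - 1)) := by
      rw [lintegral_Ioo_eq_one_sub, hN, ENNReal.ofReal_mul (by norm_num), mul_assoc,
        ← lintegral_const_mul' (ENNReal.ofReal (2 ^ (k - 1) * 2 ^ k)) _ ENNReal.ofReal_ne_top]
      congr 1
      refine setLIntegral_congr_fun measurableSet_Ioo fun v hv => ?_
      have e1 : sqDistInterp x y (1 - 2 * v) =
          ‖x - y‖ ^ 2 + (‖x - reflect y‖ ^ 2 - ‖x - y‖ ^ 2) * v := by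
        rw [sqDistInterp]; ring
      rw [e1, jacobiWeight_one_sub k hv, ENNReal.ofReal_mul (p := 2 ^ (k - 1) * 2 ^ k)
        (by positivity)]
      ring
    have h0 := H₀ x y hx hy (Or.inr h)
    rw [e] at h0
    refine (h0.trans hC₀.le ((Comparable.const_mul hN0 _).trans (by positivity) (H₁ _
      (antitoneOn_greenProfile hm (bdryProd_pos hx hy))
      (fun A hA => greenProfile_le_two_mul (bdryProd_pos hx hy) hA) _ _ (sq_nonneg _) ?_
      (by positivity)))).mono ?_
    · linarith
    · exact mul_le_mul_of_nonneg_left (mul_le_mul_of_nonneg_left hCs.1 (by positivity)) hC₀.le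
  · have hab := norm_sub_reflect_sq x y
    have e : ∫⁻ s in Ioo (-1 : ℝ) 1, greenProfile m (bdryProd x y) (sqDistInterp x y s) *
        ENNReal.ofReal (jacobiWeight k s) = ENNReal.ofReal N * ∫⁻ v in Ioo (0 : ℝ) 1,
          greenProfile m (bdryProd x y)
            (‖x - reflect y‖ ^ 2 + (‖x - y‖ ^ 2 - ‖x - reflect y‖ ^ 2) * v) *
          ENNReal.ofReal (v ^ (k + 1 - 1) * (1 - v) ^ (k - 1)) := by
      rw [lintegral_Ioo_eq_sub_one, hN, ENNReal.ofReal_mul (by norm_num), mul_assoc,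
        ← lintegral_const_mul' (ENNReal.ofReal (2 ^ (k - 1) * 2 ^ k)) _ ENNReal.ofReal_ne_top]
      congr 1
      refine setLIntegral_congr_fun measurableSet_Ioo fun v hv => ?_
      have e1 : sqDistInterp x y (2 * v - 1) =
          ‖x - reflect y‖ ^ 2 + (‖x - y‖ ^ 2 - ‖x - reflect y‖ ^ 2) * v := by
        rw [sqDistInterp]; ring
      rw [e1, jacobiWeight_sub_one k hv, ENNReal.ofReal_mul (p := 2 ^ (k - 1) * 2 ^ k)
        (by positivity)]
      ring
    have h0 := H₀ x y hx hy (Or.inl h)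
    rw [e] at h0
    refine (h0.trans hC₀.le ((Comparable.const_mul hN0 _).trans (by positivity) (H₂ _
      (antitoneOn_greenProfile hm (bdryProd_pos hx hy))
      (fun A hA => greenProfile_le_two_mul (bdryProd_pos hx hy) hA) _ _ (sq_nonneg _) ?_
      (by positivity)))).mono ?_
    · linarith
    · exact mul_le_mul_of_nonneg_left (mul_le_mul_of_nonneg_left hCs.2 (by positivity)) hC₀.le

theorem greenProfile_mul_rpow {m B A : ℝ} (hB : 0 < B) (hA : 0 < A) (q : ℝ) :
    greenProfile m B A * ENNReal.ofReal (A ^ q) =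
      ENNReal.ofReal (A ^ (-(m - q)) * (B / max B A)) := by
  have hM : 0 < max B A := lt_max_of_lt_left hB
  rw [greenProfile, ← ENNReal.ofReal_mul (by positivity)]
  congr 1
  rw [mul_right_comm, ← Real.rpow_add hA]
  congr 2; ring

theorem lintegral_greenProfile_mul_rpow {m B ε : ℝ} (hB : 0 < B) (hε : 0 ≤ ε) (D q : ℝ) :
    ∫⁻ w in Ioc ε D, greenProfile m B w * ENNReal.ofReal (w ^ (q - 1)) =
      tailIntegral (m - q) B ε D := by
  refine setLIntegral_congr_fun measurableSet_Ioc fun w hw => ?_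
  simp only [greenProfile_mul_rpow hB (hε.trans_lt hw.1)]
  congr 3; ring

/-- At ε = 0 both endpoint terms vanish when q − m > 0. This keeps x = σy within the estimate for d
= 2, 3, where the opposite-side integral converges at 0. -/
theorem greenProfile_mul_rpow_add_tail {m B ε q : ℝ} (hB : 0 < B) (hε : 0 ≤ ε) (hq : 0 < q)
    (D : ℝ) (h : 0 < ε ∨ m < q) :
    greenProfile m B ε * ENNReal.ofReal (ε ^ q) +
      ∫⁻ w in Ioc ε D, greenProfile m B w * ENNReal.ofReal (w ^ (q - 1)) =
      ENNReal.ofReal (ε ^ (-(m - q)) * (B / max B ε)) + tailIntegral (m - q) B ε D := by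
  rw [lintegral_greenProfile_mul_rpow hB hε]
  congr 1
  rcases hε.eq_or_lt with rfl | hε
  · have hmq := h.resolve_left (lt_irrefl _)
    rw [Real.zero_rpow hq.ne', Real.zero_rpow (by linarith)]
    simp
  · exact greenProfile_mul_rpow hB hε q

theorem sq_rpow_eq_rpow_two_mul {r : ℝ} (hr : 0 ≤ r) (p : ℝ) : (r ^ 2) ^ p = r ^ (2 * p) := by
  rw [← Real.rpow_natCast, ← Real.rpow_mul hr]; norm_num

/-- The Green function when the singularity at `x = y` is the nearer one. -/
theorem exists_comparable_green_same_side {k : ℝ} (hk : 0 < k) (hd : 2 ≤ d) :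
    ∃ C : ℝ, 0 < C ∧ ∀ x y : EuclideanSpace ℝ (Fin d), ‖x‖ < 1 → ‖y‖ < 1 →
      0 ≤ x 0 * y 0 → 0 < ‖x - y‖ → Comparable C (greenFunction k x y)
        (ENNReal.ofReal (‖x - reflect y‖ ^ (2 * k))⁻¹ *
          (ENNReal.ofReal ((‖x - y‖ ^ 2) ^ (-((d : ℝ) / 2 - 1)) *
            (bdryProd x y / max (bdryProd x y) (‖x - y‖ ^ 2))) +
          tailIntegral ((d : ℝ) / 2 - 1) (bdryProd x y) (‖x - y‖ ^ 2)
            (‖x - reflect y‖ ^ 2))) := by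
  have hd' : (2 : ℝ) ≤ d := by exact_mod_cast hd
  obtain ⟨C, hC, H⟩ := exists_comparable_green_affine (d := d) hk (by linarith)
  refine ⟨C, hC, fun x y hx hy hxy h => ?_⟩
  have hab := norm_sub_reflect_sq x y
  have hβ : 0 < ‖x - reflect y‖ := by
    by_contra hcon
    have : ‖x - reflect y‖ = 0 := le_antisymm (not_lt.1 hcon) (norm_nonneg _)
    rw [this] at hab
    nlinarith
  have := (H x y hx hy).1 hxy hβ
  rw [greenProfile_mul_rpow_add_tail (bdryProd_pos hx hy) (sq_nonneg _) hk _
    (Or.inl (by positivity)), sq_rpow_eq_rpow_two_mul hβ.le, mul_neg, Real.rpow_neg hβ.le] at this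
  rwa [show k + (d : ℝ) / 2 - 1 - k = (d : ℝ) / 2 - 1 by ring] at this

/-- The Green function when the singularity at `x = σy` is the nearer one. -/
theorem exists_comparable_green_opposite_side {k : ℝ} (hk : 0 < k) (hd : 2 ≤ d) :
    ∃ C : ℝ, 0 < C ∧ ∀ x y : EuclideanSpace ℝ (Fin d), ‖x‖ < 1 → ‖y‖ < 1 →
      x 0 * y 0 < 0 → (0 < ‖x - reflect y‖ ∨ d < 4) → Comparable C (greenFunction k x y)
        (ENNReal.ofReal (‖x - y‖ ^ (2 * k) * ‖x - y‖ ^ 2)⁻¹ *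
          (ENNReal.ofReal ((‖x - reflect y‖ ^ 2) ^ (-((d : ℝ) / 2 - 2)) *
            (bdryProd x y / max (bdryProd x y) (‖x - reflect y‖ ^ 2))) +
          tailIntegral ((d : ℝ) / 2 - 2) (bdryProd x y) (‖x - reflect y‖ ^ 2)
            (‖x - y‖ ^ 2))) := by
  have hd' : (2 : ℝ) ≤ d := by exact_mod_cast hd
  obtain ⟨C, hC, H⟩ := exists_comparable_green_affine (d := d) hk (by linarith)
  refine ⟨C, hC, fun x y hx hy hxy h => ?_⟩
  have hab := norm_sub_reflect_sq x y
  have hα : 0 < ‖x - y‖ := by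
    by_contra hcon
    have : ‖x - y‖ = 0 := le_antisymm (not_lt.1 hcon) (norm_nonneg _)
    rw [this] at hab
    nlinarith [sq_nonneg ‖x - reflect y‖]
  have := (H x y hx hy).2 hxy.le hα
  rw [greenProfile_mul_rpow_add_tail (bdryProd_pos hx hy) (sq_nonneg _) (by linarith) _ ?_,
    sq_rpow_eq_rpow_two_mul hα.le, mul_neg, Real.rpow_neg hα.le,
    show 2 * (k + 1) = 2 * k + (2 : ℕ) by push_cast; ring, Real.rpow_add hα,
    Real.rpow_natCast] at this
  · rwa [show k + (d : ℝ) / 2 - 1 - (k + 1) = (d : ℝ) / 2 - 2 by ring] at this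
  · rcases h with h | h
    · exact Or.inl (by positivity)
    · have : (d : ℝ) < 4 := by exact_mod_cast h
      exact Or.inr (by linarith)

/-- Off the reflecting hyperplane the tail integral diverges at 0. On it also x = σy, so A vanishes
identically and the integrand itself is infinite. -/
theorem greenFunction_eq_top_of_norm_sub_eq_zero {k : ℝ} (hk : 0 < k) (hd : 2 ≤ d)
    {x y : EuclideanSpace ℝ (Fin d)} (hx : ‖x‖ < 1) (hy : ‖y‖ < 1) (h : ‖x - y‖ = 0) :
    greenFunction k x y = ⊤ := by
  have hd' : (2 : ℝ) ≤ d := by exact_mod_cast hd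
  have hm : 0 < k + (d : ℝ) / 2 - 1 := by linarith
  have hB := bdryProd_pos hx hy
  have hab := norm_sub_reflect_sq x y
  have hxy : 0 ≤ x 0 * y 0 := by
    rw [h] at hab; nlinarith [sq_nonneg ‖x - reflect y‖]
  rcases (norm_nonneg (x - reflect y)).eq_or_lt with h' | h'
  · have hB' := ballFactor_pos hx hy
    have hmeas := measurable_jacobiWeight k
    rw [greenFunction_eq_lintegral hk hm hx hy, setLIntegral_congr_fun
      (g := fun s => ⊤ * ENNReal.ofReal (jacobiWeight k s)) measurableSet_Ioo,
      lintegral_const_mul _ (by fun_prop)]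
    · rw [ENNReal.top_mul, ENNReal.mul_top (newtonConst_ne_zero hk)]
      refine ne_of_gt (lt_of_lt_of_le (pos_iff_ne_zero.2 (lintegral_ofReal_ne_zero (a := -1)
        (b := 0) hmeas (by norm_num) fun s hs => ?_)) (lintegral_mono_set ?_))
      · exact mul_pos (Real.rpow_pos_of_pos (by linarith [hs.2]) _)
          (Real.rpow_pos_of_pos (by linarith [hs.1]) _)
      · exact fun s hs => ⟨hs.1, by linarith [hs.2]⟩
    · intro s hs
      have e : sqDistInterp x y s = 0 := by rw [sqDistInterp, h, ← h']; ring
      simp only [e, zero_add]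
      rw [ENNReal.ofReal_zero, ENNReal.zero_rpow_of_neg (by linarith), ENNReal.top_sub]
      rw [ENNReal.ofReal_rpow_of_pos hB']
      exact ENNReal.ofReal_ne_top
  · obtain ⟨C, hC, H⟩ := exists_comparable_green_affine (d := d) hk hm
    have := (H x y hx hy).1 hxy h'
    rw [h, lintegral_greenProfile_mul_rpow hB (sq_nonneg _), zero_pow two_ne_zero,
      tailIntegral_eq_top (by linarith) hB (by positivity), add_top, ENNReal.mul_top] at this
    · exact this.eq_top
    · rw [← pos_iff_ne_zero, ENNReal.ofReal_pos]
      positivity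

/-- The threshold d = 4 is where the opposite-side exponent ν = d/2 − 2 becomes nonnegative and the
tail integral diverges at 0. -/
theorem greenFunction_eq_top_of_norm_sub_reflect_eq_zero {k : ℝ} (hk : 0 < k) (hd : 4 ≤ d)
    {x y : EuclideanSpace ℝ (Fin d)} (hx : ‖x‖ < 1) (hy : ‖y‖ < 1) (h : ‖x - reflect y‖ = 0) :
    greenFunction k x y = ⊤ := by
  have hd' : (4 : ℝ) ≤ d := by exact_mod_cast hd
  have hB := bdryProd_pos hx hy
  have hab := norm_sub_reflect_sq x y
  rcases (norm_nonneg (x - y)).eq_or_lt with h' | h'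
  · exact greenFunction_eq_top_of_norm_sub_eq_zero hk (by omega) hx hy h'.symm
  · obtain ⟨C, hC, H⟩ := exists_comparable_green_affine (d := d) hk (by linarith)
    have := (H x y hx hy).2 (by rw [h] at hab; nlinarith) h'
    rw [h, lintegral_greenProfile_mul_rpow hB (sq_nonneg _), zero_pow two_ne_zero,
      tailIntegral_eq_top (by linarith) hB (by positivity), add_top, ENNReal.mul_top] at this
    · exact this.eq_top
    · rw [← pos_iff_ne_zero, ENNReal.ofReal_pos]
      positivity

/-! ### Passage from real formulas to extended nonnegative ones. -/

theorem one_div_ofReal {X : ℝ} (hX : 0 < X) : 1 / ENNReal.ofReal X = ENNReal.ofReal X⁻¹ := by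
  rw [one_div, ENNReal.ofReal_inv_of_pos hX]

/-- The form B / max B c gives the value 1 at c = 0, in agreement with B/0 = ∞; the real quotient
B/c would be 0 there. -/
theorem min_one_ofReal_div {B c : ℝ} (hB : 0 < B) (hc : 0 ≤ c) :
    min 1 (ENNReal.ofReal B / ENNReal.ofReal c) = ENNReal.ofReal (B / max B c) := by
  rcases hc.eq_or_lt with rfl | hc
  · rw [ENNReal.ofReal_zero, ENNReal.div_zero (ENNReal.ofReal_pos.2 hB).ne', max_eq_left hB.le,
      div_self hB.ne']
    simp
  · rw [← ENNReal.ofReal_div_of_pos hc, ← ENNReal.ofReal_one, ← ENNReal.ofReal_min]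
    congr 1
    rcases le_total B c with h | h
    · rw [max_eq_right h, min_eq_right ((div_le_one hc).2 h)]
    · rw [max_eq_left h, div_self hB.ne', min_eq_left ((one_le_div hc).2 h)]

/-- At r = 0 the two logarithms differ (−∞ against 0), but the maximum with 1 hides this. -/
theorem oneMaxLog_ofReal {r : ℝ} (hr : 0 ≤ r) :
    oneMaxLog (ENNReal.ofReal r) = ENNReal.ofReal (max 1 (Real.log r)) := by
  rw [oneMaxLog, ENNReal.ofReal_max, ENNReal.ofReal_one]
  rcases hr.eq_or_lt with rfl | hr
  · simp
  · rw [ENNReal.log_ofReal_of_pos hr, EReal.real_coe_toENNReal]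

theorem oneMaxLog_top : oneMaxLog ⊤ = ⊤ := by simp [oneMaxLog]

theorem oneMaxLog_ne_zero (r : ℝ≥0∞) : oneMaxLog r ≠ 0 :=
  (lt_of_lt_of_le one_pos (le_max_left _ _)).ne'

theorem oneMaxLog_ofReal_of_le_one {r : ℝ} (hr : 0 ≤ r) (hr1 : r ≤ 1) :
    oneMaxLog (ENNReal.ofReal r) = 1 := by
  rw [oneMaxLog_ofReal hr, max_eq_left ((Real.log_nonpos hr hr1).trans zero_le_one),
    ENNReal.ofReal_one]

theorem comparableOnBall_of_comparable {d : ℕ}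
    {f g : EuclideanSpace ℝ (Fin d) → EuclideanSpace ℝ (Fin d) → ℝ≥0∞}
    (H : ∃ C : ℝ, 0 < C ∧ ∀ x y, ‖x‖ < 1 → ‖y‖ < 1 → Comparable C (f x y) (g x y)) :
    ComparableOnBall f g := by
  obtain ⟨C, hC, H⟩ := H
  refine ⟨C, hC, fun x hx y hy => ?_⟩
  have h := H x y (mem_ball_zero_iff.1 hx) (mem_ball_zero_iff.1 hy)
  refine ⟨?_, h.1⟩
  calc ENNReal.ofReal C⁻¹ * g x y ≤ ENNReal.ofReal C⁻¹ * (ENNReal.ofReal C * f x y) := by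
        gcongr; exact h.2
    _ = f x y := by
        rw [← mul_assoc, ← ENNReal.ofReal_mul (by positivity), inv_mul_cancel₀ hC.ne']
        simp

theorem edist_eq_ofReal_norm {d : ℕ} (x y : EuclideanSpace ℝ (Fin d)) :
    edist x y = ENNReal.ofReal ‖x - y‖ := by rw [edist_dist, dist_eq_norm]

theorem Phi_eq_of_nonneg {x y : EuclideanSpace ℝ (Fin d)} (h : 0 ≤ x 0 * y 0) :
    Phi x y = ENNReal.ofReal ‖x - reflect y‖ := by
  have hab := norm_sub_reflect_sq x y
  rw [Phi, edist_eq_ofReal_norm, edist_eq_ofReal_norm, max_eq_right]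
  exact ENNReal.ofReal_le_ofReal (abs_le_of_sq_le_sq' (by linarith) (norm_nonneg _)).2

theorem Phi_eq_of_nonpos {x y : EuclideanSpace ℝ (Fin d)} (h : x 0 * y 0 ≤ 0) :
    Phi x y = ENNReal.ofReal ‖x - y‖ := by
  have hab := norm_sub_reflect_sq x y
  rw [Phi, edist_eq_ofReal_norm, edist_eq_ofReal_norm, max_eq_left]
  exact ENNReal.ofReal_le_ofReal (abs_le_of_sq_le_sq' (by linarith) (norm_nonneg _)).2

theorem bdryDist_mul_bdryDist {d : ℕ} {x : EuclideanSpace ℝ (Fin d)} (hx : ‖x‖ < 1)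
    (y : EuclideanSpace ℝ (Fin d)) :
    bdryDist x * bdryDist y = ENNReal.ofReal (bdryProd x y) := by
  rw [bdryDist, bdryDist, bdryProd, ENNReal.ofReal_mul (by linarith)]

/-- The three possible positions of a pair of points with respect to the reflection, with the
elementary facts about the distances that hold there. -/
theorem position_cases (x y : EuclideanSpace ℝ (Fin d)) :
    ‖x - y‖ = 0 ∨
    (0 < ‖x - y‖ ∧ 0 ≤ x 0 * y 0 ∧ 0 < ‖x - reflect y‖ ∧ ‖x - y‖ ≤ ‖x - reflect y‖ ∧
      (‖x - reflect y‖ ^ 2 - ‖x - y‖ ^ 2) / 4 = |x 0 * y 0|) ∨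
    (0 < ‖x - y‖ ∧ x 0 * y 0 < 0 ∧ ‖x - reflect y‖ ≤ ‖x - y‖ ∧
      (‖x - y‖ ^ 2 - ‖x - reflect y‖ ^ 2) / 4 = |x 0 * y 0|) := by
  have hab := norm_sub_reflect_sq x y
  rcases (norm_nonneg (x - y)).eq_or_lt with h | h
  · exact Or.inl h.symm
  · right
    rcases le_or_gt 0 (x 0 * y 0) with hxy | hxy
    · have hle : ‖x - y‖ ≤ ‖x - reflect y‖ :=
        (abs_le_of_sq_le_sq' (by linarith) (norm_nonneg _)).2
      exact Or.inl ⟨h, hxy, h.trans_le hle, hle, by rw [abs_of_nonneg hxy]; linarith⟩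
    · have hle : ‖x - reflect y‖ ≤ ‖x - y‖ :=
        (abs_le_of_sq_le_sq' (by linarith) (norm_nonneg _)).2
      exact Or.inr ⟨h, hxy, hle, by rw [abs_of_neg hxy]; linarith⟩

/-! ### The four ranges of the dimension. -/

/-- Here ν = 0 on the same side and ν = −1 on opposite sides. Off the diagonal at most one logarithm
is active: |x₁y₁| ≤ b/4 kills the second on the same side, and |x₁y₁| ≤ a/4 kills the first on
opposite sides. -/
theorem comparableOnBall_two {k : ℝ} (hk : 0 < k) (hd : d = 2) :
    ComparableOnBall (d := d) (greenFunction k) fun x y =>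
      1 / Phi x y ^ (2 * k) *
        min 1 (bdryDist x * bdryDist y / edist x y ^ 2) *
        oneMaxLog (min ‖x 0 * y 0‖ₑ (bdryDist x * bdryDist y) / edist x y ^ 2) *
        oneMaxLog (‖x 0 * y 0‖ₑ / max (bdryDist x * bdryDist y) (edist x (reflect y) ^ 2)) := by
  obtain ⟨C₁, hC₁, H₁⟩ := exists_comparable_green_same_side (d := d) hk hd.ge
  obtain ⟨C₂, hC₂, H₂⟩ := exists_comparable_green_opposite_side (d := d) hk hd.ge
  rw [show (d : ℝ) / 2 - 1 = 0 by rw [hd]; norm_num] at H₁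
  rw [show (d : ℝ) / 2 - 2 = -1 by rw [hd]; norm_num] at H₂
  refine comparableOnBall_of_comparable ⟨(C₁ + C₂) * 6, by positivity, fun x y hx hy => ?_⟩
  have hB := bdryProd_pos hx hy
  rw [bdryDist_mul_bdryDist hx, edist_eq_ofReal_norm, edist_eq_ofReal_norm,
    Real.enorm_eq_ofReal_abs, ← ENNReal.ofReal_pow (norm_nonneg _),
    ← ENNReal.ofReal_pow (norm_nonneg _), min_one_ofReal_div hB (sq_nonneg _),
    ← ENNReal.ofReal_min, ← ENNReal.ofReal_max]
  have hab := norm_sub_reflect_sq x y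
  rcases position_cases x y with h | ⟨hα, hxy, hβ, hle, hp⟩ | ⟨hα, hxy, hle, hp⟩
  · rw [greenFunction_eq_top_of_norm_sub_eq_zero hk hd.ge hx hy h, h, zero_pow two_ne_zero,
      max_eq_left hB.le, div_self hB.ne', ENNReal.ofReal_one, mul_one]
    have hxy : 0 ≤ x 0 * y 0 := by
      rw [h] at hab; nlinarith [sq_nonneg ‖x - reflect y‖]
    convert Comparable.top (C := (C₁ + C₂) * 6) (by positivity) using 1
    refine ENNReal.mul_eq_top.2 (Or.inr ⟨?_, oneMaxLog_ne_zero _⟩)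
    rw [Phi_eq_of_nonneg hxy]
    -- On the diagonal the infinity comes from Φ = 0 if x₁ = 0, and otherwise from the first
    -- logarithm.
    rcases (norm_nonneg (x - reflect y)).eq_or_lt with h' | h'
    · rw [← h', ENNReal.ofReal_zero, ENNReal.zero_rpow_of_pos (by linarith),
        ENNReal.div_zero one_ne_zero, ENNReal.top_mul (oneMaxLog_ne_zero _)]
    · have hp : 0 < |x 0 * y 0| := by
        rw [abs_of_nonneg hxy]
        rw [h] at hab
        nlinarith
      rw [ENNReal.ofReal_zero, ENNReal.div_zero (ENNReal.ofReal_pos.2 (lt_min hp hB)).ne',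
        oneMaxLog_top, ENNReal.mul_top]
      rw [ENNReal.ofReal_rpow_of_pos h', one_div_ofReal (by positivity)]
      exact (ENNReal.ofReal_pos.2 (by positivity)).ne'
  · have h1 := H₁ x y hx hy hxy hα
    rw [neg_zero, Real.rpow_zero, one_mul] at h1
    have h2 := h1.trans hC₁.le ((comparable_tail_zero hB (pow_pos hα 2) (by gcongr)).mul_left _)
    rw [hp] at h2
    rw [Phi_eq_of_nonneg hxy, ENNReal.ofReal_rpow_of_pos hβ, one_div_ofReal (by positivity),
      ← ENNReal.ofReal_div_of_pos (by positivity), ← ENNReal.ofReal_div_of_pos (by positivity),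
      oneMaxLog_ofReal (by positivity), oneMaxLog_ofReal_of_le_one (by positivity), mul_one,
      mul_assoc, ← ENNReal.ofReal_mul (by positivity)]
    · exact h2.mono (by linarith)
    · rw [div_le_one (by positivity)]
      refine le_max_of_le_right ?_
      rw [← hp]
      nlinarith [sq_nonneg ‖x - y‖, sq_nonneg ‖x - reflect y‖]
  · have h1 := H₂ x y hx hy hxy (Or.inr (by omega))
    rw [neg_neg, Real.rpow_one] at h1
    have h2 := h1.trans hC₂.le ((comparable_tail_neg_one hB (sq_nonneg _) (by gcongr)
      (by positivity)).mul_left _)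
    rw [hp] at h2
    rw [Phi_eq_of_nonpos hxy.le, ENNReal.ofReal_rpow_of_pos hα, one_div_ofReal (by positivity),
      ← ENNReal.ofReal_div_of_pos (by positivity), ← ENNReal.ofReal_div_of_pos (by positivity),
      oneMaxLog_ofReal_of_le_one (by positivity), mul_one, oneMaxLog_ofReal (by positivity),
      ← ENNReal.ofReal_mul (by positivity), ← ENNReal.ofReal_mul (by positivity)]
    · rw [← ENNReal.ofReal_mul (by positivity)] at h2
      convert h2.mono (show C₂ * 6 ≤ (C₁ + C₂) * 6 by linarith) using 2
      rw [← mul_assoc]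
      congr 1
      -- The extra |x−y|^{−2} of the opposite side and the factor D ∧ B of the tail combine to 1 ∧
      -- B/|x−y|².
      have : bdryProd x y / max (bdryProd x y) (‖x - y‖ ^ 2) =
          (‖x - y‖ ^ 2)⁻¹ * min (‖x - y‖ ^ 2) (bdryProd x y) := by
        rcases le_total (bdryProd x y) (‖x - y‖ ^ 2) with h | h
        · rw [max_eq_right h, min_eq_right h]; field_simp
        · rw [max_eq_left h, min_eq_left h]; field_simp
      rw [this, mul_inv, mul_assoc]
    · rw [div_le_one (by positivity)]
      refine (min_le_left _ _).trans ?_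
      rw [← hp]
      nlinarith [sq_nonneg ‖x - y‖, sq_nonneg ‖x - reflect y‖]

theorem comparableOnBall_three {k : ℝ} (hk : 0 < k) (hd : d = 3) :
    ComparableOnBall (d := d) (greenFunction k) fun x y =>
      1 / (Phi x y ^ (2 * k) * edist x y) *
        min 1 ((bdryDist x * bdryDist y) ^ (1 / 2 : ℝ) / edist x y) *
        min 1 ((bdryDist x * bdryDist y) ^ (1 / 2 : ℝ) /
          min (edist x y) (edist x (reflect y))) := by
  obtain ⟨C₁, hC₁, H₁⟩ := exists_comparable_green_same_side (d := d) hk (by omega)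
  obtain ⟨C₂, hC₂, H₂⟩ := exists_comparable_green_opposite_side (d := d) hk (by omega)
  rw [show (d : ℝ) / 2 - 1 = 1 / 2 by rw [hd]; norm_num] at H₁
  rw [show (d : ℝ) / 2 - 2 = -1 / 2 by rw [hd]; norm_num] at H₂
  refine comparableOnBall_of_comparable ⟨(C₁ + C₂) * 6, by positivity, fun x y hx hy => ?_⟩
  have hB := bdryProd_pos hx hy
  have hsB := Real.sqrt_pos.2 hB
  rw [bdryDist_mul_bdryDist hx, edist_eq_ofReal_norm, edist_eq_ofReal_norm,
    ENNReal.ofReal_rpow_of_pos hB, ← Real.sqrt_eq_rpow, ← ENNReal.ofReal_min,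
    min_one_ofReal_div hsB (norm_nonneg _),
    min_one_ofReal_div hsB (le_min (norm_nonneg _) (norm_nonneg _))]
  rcases position_cases x y with h | ⟨hα, hxy, hβ, hle, hp⟩ | ⟨hα, hxy, hle, hp⟩
  · rw [greenFunction_eq_top_of_norm_sub_eq_zero hk (by omega) hx hy h, h, ENNReal.ofReal_zero,
      mul_zero, ENNReal.div_zero one_ne_zero, ENNReal.top_mul, ENNReal.top_mul]
    · exact Comparable.top (by positivity)
    · exact (ENNReal.ofReal_pos.2 (by positivity)).ne'
    · exact (ENNReal.ofReal_pos.2 (by positivity)).ne'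
  · have h1 := H₁ x y hx hy hxy hα
    have h2 := h1.trans hC₁.le ((comparable_tail_of_pos (by norm_num) hB (pow_pos hα 2)
      _).mul_left _)
    rw [Phi_eq_of_nonneg hxy, ENNReal.ofReal_rpow_of_pos hβ, ← ENNReal.ofReal_mul (by positivity),
      one_div_ofReal (by positivity), ← ENNReal.ofReal_mul (by positivity),
      ← ENNReal.ofReal_mul (by positivity)]
    rw [← ENNReal.ofReal_mul (by positivity)] at h2
    convert h2.mono (show C₁ * (1 + (1 / 2)⁻¹) ≤ (C₁ + C₂) * 6 by norm_num; linarith) using 2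
    have e1 : (‖x - y‖ ^ 2) ^ (-(1 / 2 : ℝ)) = ‖x - y‖⁻¹ := by
      rw [sq_rpow_eq_rpow_two_mul hα.le, ← Real.rpow_neg_one]; norm_num
    -- On the same side the two minimum factors coincide, and their product is 1 ∧ B/|x−y|².
    have e2 : √(bdryProd x y) / max √(bdryProd x y) ‖x - y‖ *
        (√(bdryProd x y) / max √(bdryProd x y) ‖x - y‖) =
        bdryProd x y / max (bdryProd x y) (‖x - y‖ ^ 2) := by
      rw [div_mul_div_comm, Real.mul_self_sqrt hB.le]
      congr 1
      rcases le_total √(bdryProd x y) ‖x - y‖ with h | h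
      · rw [max_eq_right h, max_eq_right ((Real.sqrt_le_left hα.le).1 h), sq]
      · rw [max_eq_left h, max_eq_left ((Real.le_sqrt hα.le hB.le).1 h),
          Real.mul_self_sqrt hB.le]
    rw [e1, ← e2, min_eq_left hle, mul_inv]
    ring
  · have h1 := H₂ x y hx hy hxy (Or.inr (by omega))
    rw [show -(-1 / 2 : ℝ) = 1 / 2 by norm_num, ← Real.sqrt_eq_rpow] at h1
    have h2 := h1.trans hC₂.le ((comparable_tail_neg_half hB (sq_nonneg _) (by gcongr)
      (by positivity)).mul_left _)
    rw [Real.sqrt_sq (norm_nonneg _), Real.sqrt_sq (norm_nonneg _),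
      ← ENNReal.ofReal_mul (by positivity)] at h2
    rw [Phi_eq_of_nonpos hxy.le, ENNReal.ofReal_rpow_of_pos hα,
      ← ENNReal.ofReal_mul (by positivity), one_div_ofReal (by positivity),
      ← ENNReal.ofReal_mul (by positivity), ← ENNReal.ofReal_mul (by positivity)]
    convert h2.mono (show C₂ * 6 ≤ (C₁ + C₂) * 6 by linarith) using 2
    rw [min_eq_right hle, ← mul_assoc]
    congr 1
    rcases le_total √(bdryProd x y) ‖x - y‖ with h | h
    · rw [max_eq_right h, min_eq_right h]; field_simp
    · rw [max_eq_left h, min_eq_left h]; field_simp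

theorem comparableOnBall_four {k : ℝ} (hk : 0 < k) (hd : d = 4) :
    ComparableOnBall (d := d) (greenFunction k) fun x y =>
      1 / (Phi x y ^ (2 * k) * edist x y ^ 2) *
        min 1 (bdryDist x * bdryDist y / min (edist x y ^ 2) (edist x (reflect y) ^ 2)) *
        oneMaxLog (min ‖x 0 * y 0‖ₑ (bdryDist x * bdryDist y) / edist x (reflect y) ^ 2) := by
  obtain ⟨C₁, hC₁, H₁⟩ := exists_comparable_green_same_side (d := d) hk (by omega)
  obtain ⟨C₂, hC₂, H₂⟩ := exists_comparable_green_opposite_side (d := d) hk (by omega)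
  rw [show (d : ℝ) / 2 - 1 = 1 by rw [hd]; norm_num] at H₁
  rw [show (d : ℝ) / 2 - 2 = 0 by rw [hd]; norm_num] at H₂
  refine comparableOnBall_of_comparable ⟨(C₁ + C₂) * 6, by positivity, fun x y hx hy => ?_⟩
  have hB := bdryProd_pos hx hy
  rw [bdryDist_mul_bdryDist hx, edist_eq_ofReal_norm, edist_eq_ofReal_norm,
    Real.enorm_eq_ofReal_abs, ← ENNReal.ofReal_pow (norm_nonneg _),
    ← ENNReal.ofReal_pow (norm_nonneg _), ← ENNReal.ofReal_min, ← ENNReal.ofReal_min,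
    min_one_ofReal_div hB (le_min (sq_nonneg _) (sq_nonneg _))]
  have hu : ENNReal.ofReal (bdryProd x y /
      max (bdryProd x y) (min (‖x - y‖ ^ 2) (‖x - reflect y‖ ^ 2))) ≠ 0 :=
    (ENNReal.ofReal_pos.2 (by positivity)).ne'
  rcases position_cases x y with h | ⟨hα, hxy, hβ, hle, hp⟩ | ⟨hα, hxy, hle, hp⟩
  · rw [greenFunction_eq_top_of_norm_sub_eq_zero hk (by omega) hx hy h]
    nth_rewrite 1 [h]
    rw [zero_pow two_ne_zero, ENNReal.ofReal_zero, mul_zero, ENNReal.div_zero one_ne_zero,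
      ENNReal.top_mul hu, ENNReal.top_mul (oneMaxLog_ne_zero _)]
    exact Comparable.top (by positivity)
  · have h1 := H₁ x y hx hy hxy hα
    have h2 := h1.trans hC₁.le ((comparable_tail_of_pos one_pos hB (pow_pos hα 2)
      _).mul_left _)
    rw [Phi_eq_of_nonneg hxy, ENNReal.ofReal_rpow_of_pos hβ, ← ENNReal.ofReal_mul (by positivity),
      one_div_ofReal (by positivity), ← ENNReal.ofReal_mul (by positivity),
      ← ENNReal.ofReal_div_of_pos (by positivity), oneMaxLog_ofReal_of_le_one (by positivity),
      mul_one]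
    · rw [← ENNReal.ofReal_mul (by positivity)] at h2
      convert h2.mono (show C₁ * (1 + 1⁻¹) ≤ (C₁ + C₂) * 6 by norm_num; linarith) using 2
      rw [min_eq_left (by gcongr), Real.rpow_neg_one, mul_inv, mul_assoc]
    · rw [div_le_one (by positivity)]
      refine (min_le_left _ _).trans ?_
      rw [← hp]
      nlinarith [sq_nonneg ‖x - y‖, sq_nonneg ‖x - reflect y‖]
  -- At x = σy the logarithm carries the infinity, since |x₁y₁| and B are both positive.
  · rcases (norm_nonneg (x - reflect y)).eq_or_lt with h' | hβ
    · rw [greenFunction_eq_top_of_norm_sub_reflect_eq_zero hk hd.ge hx hy h'.symm,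
        Phi_eq_of_nonpos hxy.le, ENNReal.ofReal_rpow_of_pos hα,
        ← ENNReal.ofReal_mul (by positivity), one_div_ofReal (by positivity)]
      nth_rewrite 2 [← h']
      rw [zero_pow two_ne_zero, ENNReal.ofReal_zero, ENNReal.div_zero, oneMaxLog_top,
        ENNReal.mul_top]
      · exact Comparable.top (by positivity)
      · exact mul_ne_zero (ENNReal.ofReal_pos.2 (by positivity)).ne' hu
      · exact (ENNReal.ofReal_pos.2 (lt_min (abs_pos.2 hxy.ne) hB)).ne'
    · have h1 := H₂ x y hx hy hxy (Or.inl hβ)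
      rw [neg_zero, Real.rpow_zero, one_mul] at h1
      have h2 := h1.trans hC₂.le ((comparable_tail_zero hB (pow_pos hβ 2) (by gcongr)).mul_left _)
      rw [hp] at h2
      rw [Phi_eq_of_nonpos hxy.le, ENNReal.ofReal_rpow_of_pos hα,
        ← ENNReal.ofReal_mul (by positivity), one_div_ofReal (by positivity),
        ← ENNReal.ofReal_div_of_pos (by positivity), oneMaxLog_ofReal (by positivity),
        mul_assoc, ← ENNReal.ofReal_mul (by positivity), min_eq_right (a := ‖x - y‖ ^ 2)
        (by gcongr)]
      exact h2.mono (by linarith)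

theorem comparableOnBall_of_five_le {k : ℝ} (hk : 0 < k) (hd : 5 ≤ d) :
    ComparableOnBall (d := d) (greenFunction k) fun x y =>
      1 / (Phi x y ^ (2 * k) * min (edist x y) (edist x (reflect y)) ^ (d - 4) *
          edist x y ^ 2) *
        min 1 (bdryDist x * bdryDist y / min (edist x y ^ 2) (edist x (reflect y) ^ 2)) := by
  have hd' : (5 : ℝ) ≤ d := by exact_mod_cast hd
  obtain ⟨C₁, hC₁, H₁⟩ := exists_comparable_green_same_side (d := d) hk (by omega)
  obtain ⟨C₂, hC₂, H₂⟩ := exists_comparable_green_opposite_side (d := d) hk (by omega)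
  have hν₁ : 0 < (d : ℝ) / 2 - 1 := by linarith
  have hν₂ : 0 < (d : ℝ) / 2 - 2 := by linarith
  refine comparableOnBall_of_comparable
    ⟨C₁ * (1 + ((d : ℝ) / 2 - 1)⁻¹) + C₂ * (1 + ((d : ℝ) / 2 - 2)⁻¹), by positivity,
      fun x y hx hy => ?_⟩
  have hB := bdryProd_pos hx hy
  have hpow : ∀ r : ℝ, 0 < r → (r ^ 2) ^ (-((d : ℝ) / 2 - 2)) = (r ^ (d - 4))⁻¹ := by
    intro r hr
    rw [sq_rpow_eq_rpow_two_mul hr.le, ← Real.rpow_natCast r (d - 4), ← Real.rpow_neg hr.le]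
    congr 1
    rw [Nat.cast_sub (by omega)]
    push_cast; ring
  rw [bdryDist_mul_bdryDist hx, edist_eq_ofReal_norm, edist_eq_ofReal_norm,
    ← ENNReal.ofReal_min, ← ENNReal.ofReal_pow (norm_nonneg _),
    ← ENNReal.ofReal_pow (norm_nonneg _), ← ENNReal.ofReal_pow (by positivity),
    ← ENNReal.ofReal_min, min_one_ofReal_div hB (le_min (sq_nonneg _) (sq_nonneg _))]
  have hu : ENNReal.ofReal (bdryProd x y /
      max (bdryProd x y) (min (‖x - y‖ ^ 2) (‖x - reflect y‖ ^ 2))) ≠ 0 :=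
    (ENNReal.ofReal_pos.2 (by positivity)).ne'
  have hc₁ : 0 < C₁ * (1 + ((d : ℝ) / 2 - 1)⁻¹) := by positivity
  have hc₂ : 0 < C₂ * (1 + ((d : ℝ) / 2 - 2)⁻¹) := by positivity
  rcases position_cases x y with h | ⟨hα, hxy, hβ, hle, hp⟩ | ⟨hα, hxy, hle, hp⟩
  · rw [greenFunction_eq_top_of_norm_sub_eq_zero hk (by omega) hx hy h]
    nth_rewrite 2 [h]
    rw [zero_pow two_ne_zero, ENNReal.ofReal_zero, mul_zero, ENNReal.div_zero one_ne_zero,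
      ENNReal.top_mul hu]
    exact Comparable.top (by positivity)
  · have h1 := H₁ x y hx hy hxy hα
    have h2 := h1.trans hC₁.le ((comparable_tail_of_pos hν₁ hB (pow_pos hα 2) _).mul_left _)
    rw [Phi_eq_of_nonneg hxy, ENNReal.ofReal_rpow_of_pos hβ, min_eq_left hle,
      min_eq_left (by gcongr), ← ENNReal.ofReal_mul (by positivity),
      ← ENNReal.ofReal_mul (by positivity),
      one_div_ofReal (by positivity), ← ENNReal.ofReal_mul (by positivity)]
    rw [← ENNReal.ofReal_mul (by positivity)] at h2
    convert h2.mono (le_add_of_nonneg_right hc₂.le) using 2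
    -- On the same side the minimum distance is |x−y|, so the powers d−4 and 2 merge into d−2.
    have e : (‖x - y‖ ^ 2) ^ (-((d : ℝ) / 2 - 1)) = (‖x - y‖ ^ (d - 4) * ‖x - y‖ ^ 2)⁻¹ := by
      rw [mul_inv, ← hpow _ hα, ← Real.rpow_neg_one (‖x - y‖ ^ 2), ← Real.rpow_add (by positivity)]
      congr 1; ring
    rw [e, mul_assoc, mul_inv, mul_assoc]
  · rcases (norm_nonneg (x - reflect y)).eq_or_lt with h' | hβ
    · rw [greenFunction_eq_top_of_norm_sub_reflect_eq_zero hk (by omega) hx hy h'.symm,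
        min_eq_right hle]
      nth_rewrite 1 [← h']
      rw [zero_pow (by omega), ENNReal.ofReal_zero, mul_zero, zero_mul,
        ENNReal.div_zero one_ne_zero, ENNReal.top_mul hu]
      exact Comparable.top (by positivity)
    · have h1 := H₂ x y hx hy hxy (Or.inl hβ)
      have h2 := h1.trans hC₂.le ((comparable_tail_of_pos hν₂ hB (pow_pos hβ 2) _).mul_left _)
      rw [Phi_eq_of_nonpos hxy.le, ENNReal.ofReal_rpow_of_pos hα, min_eq_right hle,
        min_eq_right (by gcongr), ← ENNReal.ofReal_mul (by positivity),
        ← ENNReal.ofReal_mul (by positivity),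
        one_div_ofReal (by positivity), ← ENNReal.ofReal_mul (by positivity)]
      rw [← ENNReal.ofReal_mul (by positivity), hpow _ hβ] at h2
      convert h2.mono (le_add_of_nonneg_left hc₁.le) using 2
      rw [mul_inv, mul_inv, mul_inv]
      ring

end Green

end RankOneDunkl

end

theorem theorem5p4 {d : ℕ} [NeZero d] (k : ℝ) (hk : 0 < k) :
    (d = 2 → ComparableOnBall (d := d) (greenFunction k) fun x y =>
      1 / Phi x y ^ (2 * k) *
        min 1 (bdryDist x * bdryDist y / edist x y ^ 2) *
        oneMaxLog (min ‖x 0 * y 0‖ₑ (bdryDist x * bdryDist y) / edist x y ^ 2) *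
        oneMaxLog (‖x 0 * y 0‖ₑ / max (bdryDist x * bdryDist y) (edist x (reflect y) ^ 2))) ∧
    (d = 3 → ComparableOnBall (d := d) (greenFunction k) fun x y =>
      1 / (Phi x y ^ (2 * k) * edist x y) *
        min 1 ((bdryDist x * bdryDist y) ^ (1 / 2 : ℝ) / edist x y) *
        min 1 ((bdryDist x * bdryDist y) ^ (1 / 2 : ℝ) /
          min (edist x y) (edist x (reflect y)))) ∧
    (d = 4 → ComparableOnBall (d := d) (greenFunction k) fun x y =>
      1 / (Phi x y ^ (2 * k) * edist x y ^ 2) *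
        min 1 (bdryDist x * bdryDist y / min (edist x y ^ 2) (edist x (reflect y) ^ 2)) *
        oneMaxLog (min ‖x 0 * y 0‖ₑ (bdryDist x * bdryDist y) / edist x (reflect y) ^ 2)) ∧
    (5 ≤ d → ComparableOnBall (d := d) (greenFunction k) fun x y =>
      1 / (Phi x y ^ (2 * k) * min (edist x y) (edist x (reflect y)) ^ (d - 4) *
          edist x y ^ 2) *
        min 1 (bdryDist x * bdryDist y / min (edist x y ^ 2) (edist x (reflect y) ^ 2))) := by
  exact ⟨comparableOnBall_two hk, comparableOnBall_three hk, comparableOnBall_four hk,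
    comparableOnBall_of_five_le hk⟩
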